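/- Let $H(\mathbb C)$ be the algebra of entire functions with the compact-open topology, and $D$ the operator of complex differentiation on it. For a non-constant entire $f$ put $M(r)=\sup_{|z|\le r}|f(z)|$; its order is $\rho=\limsup_{r\to\infty}\frac{\log\log M(r)}{\log r}$ and, if $\rho<\infty$, its type is $\limsup_{r\to\infty} r^{-\rho}\log M(r)$. We say that $f$ is of growth $(1,\tau)$ if either $\rho<1$, or $\rho=1$ and its type is at most $\tau$; $f$ is of exponential type if it is of growth $(1,\tau)$ for some $\tau<\infty$, and of subexponential growth if it is of growth $(1,0)$. For $\Phi(z)=\sum_{n\ge 0} c_nz^n$ of exponential type, $\Phi(D):H(\mathbb C)\to H(\mathbb C)$ is the operator $f\mapsto\sum_{n\ge 0}c_nD^nf$. A hypercyclic algebra for an operator $T$ on $H(\mathbb C)$ is a nonzero (not necessarily unital) subalgebra of $H(\mathbb C)$ in which every nonzero element $f$ has a dense orbit $\{T^nf:n\ge 0\}$. **Theorem 1.2.** Let $\Phi$ be a non-constant entire function of exponential type with $\Phi(0)=1$. (a) If $\Phi$ is of subexponential growth, then $\Phi(D)$ has a hypercyclic algebra. (b) Suppose $\Phi$ is not of subexponential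 growth. 1. If $\Phi$ has no zeros, then $\Phi(D)$ has no hypercyclic algebra. 2. If $\Phi(z)=e^{az}p(z)$ for some non-constant polynomial $p(z)=1+a_1z+a_2z^2+\dots+a_rz^r$ (with $a_2=0$ if $r=1$) and some scalar $a\neq 0$ such that $a_1a^{-1}\in\mathbb C\setminus\mathbb R$ or $2a_2\ne a_1^2$, then $\Phi(D)$ has a hypercyclic algebra. 3. Suppose $\Phi$ has infinitely many zeros, and let $\Phi(z)=e^{az}\prod_{n=1}^\infty E_p(z/z_n)$ be its Hadamard factorization, where $(z_n)$ lists the zeros of $\Phi$ with multiplicity so that $0<|z_1|\le|z_2|\le\cdots$, where $p$ is the least integer $k\ge 0$ such that $\sum_n|z_n|^{-k}=\infty$ and $\sum_n|z_n|^{-(k+1)}<\infty$, and where $E_p(z)=(1-z)\exp\left(\sum_{k=1}^p z^k/k\right)$. Assume $\sum_{n=1}^\infty z_n^{-2}\neq 0$. - (i) If $\sum_{n=1}^\infty|z_n|^{-1}$ converges, then $\Phi(D)$ has a hypercyclic algebra. - (ii) If $\sum_{n=1}^\infty|z_n|^{-1}$ diverges and $a\ne 0$, then $\Phi(D)$ has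 a hypercyclic algebra. -/

import Mathlib

open Filter Topology

noncomputable section

namespace HypercyclicAlgebra

/-! ### Growth of entire functions -/

/-- The maximum modulus `M(r) = sup_{|z| ≤ r} |f z|`. -/
def maxModulus (f : ℂ → ℂ) (r : ℝ) : ℝ :=
  sSup ((fun z => ‖f z‖) '' Metric.closedBall (0 : ℂ) r)

open Classical in
/-- The order of an entire function: zero for a constant function, and
`limsup_{r → ∞} log log M(r) / log r` (an extended real number) otherwise. -/
def growthOrder (f : ℂ → ℂ) : EReal :=
  if ∃ c, ∀ z, f z = c then 0
  else limsup (fun r : ℝ =>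
    ((Real.log (Real.log (maxModulus f r)) / Real.log r : ℝ) : EReal)) atTop

/-- The type of an entire function of finite order `ρ`, namely
`limsup_{r → ∞} r ^ (-ρ) * log M(r)`. -/
def growthType (f : ℂ → ℂ) : EReal :=
  limsup (fun r : ℝ =>
    ((r ^ (-(growthOrder f).toReal) * Real.log (maxModulus f r) : ℝ) : EReal)) atTop

/-- `f` is of growth `(ρ, τ)`: its order is less than `ρ`, or its order equals `ρ` and its type
does not exceed `τ`. -/
def HasGrowth (f : ℂ → ℂ) (ρ τ : ℝ) : Prop :=
  growthOrder f < (ρ : EReal) ∨ (growthOrder f = (ρ : EReal) ∧ growthType f ≤ (τ : EReal))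

/-- `f` is of subexponential growth: it is of growth `(1, 0)`. -/
def IsSubexponential (f : ℂ → ℂ) : Prop := HasGrowth f 1 0

/-- `f` is of exponential type: it is of growth `(1, τ)` for some finite `τ`. -/
def IsExponentialType (f : ℂ → ℂ) : Prop := ∃ τ : ℝ, HasGrowth f 1 τ

/-! ### The algebra of entire functions and convolution operators -/

/-- The algebra `H(ℂ)` of entire functions, as a subalgebra of `C(ℂ, ℂ)`. Its topology is the one
induced by `C(ℂ, ℂ)`, that is, the compact-open topology. -/
def entireFunctions : Subalgebra ℂ C(ℂ, ℂ) where
  carrier := {f | Differentiable ℂ (f : ℂ → ℂ)}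
  mul_mem' := by
    intro f g hf hg
    exact Differentiable.mul hf hg
  add_mem' := by
    intro f g hf hg
    exact Differentiable.add hf hg
  algebraMap_mem' := by
    intro c
    exact differentiable_const c

/-- The operator `D` of complex differentiation on `H(ℂ)`. -/
def diffOp : entireFunctions →ₗ[ℂ] entireFunctions where
  toFun f := ⟨⟨deriv (f : C(ℂ, ℂ)), f.2.contDiff.continuous_deriv le_top⟩,
    f.2.contDiff.differentiable_deriv_two⟩
  map_add' f g := by
    ext z
    exact deriv_add (f.2 z) (g.2 z)
  map_smul' c f := by
    ext z
    exact deriv_const_smul c (f.2 z)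

/-- The convolution operator `Φ(D) : H(ℂ) → H(ℂ)`, `f ↦ ∑ aₙ Dⁿ f`, where `Φ(z) = ∑ aₙ zⁿ` is the
Taylor expansion at `0`. The sum is taken in the topology of `H(ℂ)`, in which the series converges
absolutely for every `f` when `Φ` is of exponential type. -/
def convolutionOp (Φ : ℂ → ℂ) (f : entireFunctions) : entireFunctions :=
  ∑' n : ℕ, (iteratedDeriv n Φ 0 / (n.factorial : ℂ)) • (diffOp ^ n) f

/-! ### Hypercyclicity -/

/-- `x` is a hypercyclic vector for `T`: its orbit `{Tⁿ x : n ≥ 0}` is dense. -/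
def IsHypercyclicVector {X : Type*} [TopologicalSpace X] (T : X → X) (x : X) : Prop :=
  Dense (Set.range fun n : ℕ => T^[n] x)

/-- `T` has a hypercyclic algebra: a nonzero subalgebra (not required to contain the unit) all of
whose nonzero elements are hypercyclic vectors for `T`. -/
def HasHypercyclicAlgebra {X : Type*} [TopologicalSpace X] [Ring X] [Algebra ℂ X]
    (T : X → X) : Prop :=
  ∃ A : NonUnitalSubalgebra ℂ X, A ≠ ⊥ ∧ ∀ f ∈ A, f ≠ 0 → IsHypercyclicVector T f

/-! ### Hadamard factorization -/

/-- The Weierstrass canonical factor `E_p(z) = (1 - z) exp (z + z^2/2 + ⋯ + z^p/p)`. -/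
def canonicalFactor (p : ℕ) (z : ℂ) : ℂ :=
  (1 - z) * Complex.exp (∑ k ∈ Finset.Icc 1 p, z ^ k / (k : ℂ))

/-- `(z n)` lists the zeros of `Φ`, which are infinitely many and all nonzero, according to
multiplicity and in order of nondecreasing modulus. -/
structure IsZeroSequence (Φ : ℂ → ℂ) (z : ℕ → ℂ) : Prop where
  ne_zero : ∀ n, z n ≠ 0
  monotone_norm : Monotone fun n => ‖z n‖
  multiplicity : ∀ w, {n | z n = w}.encard = analyticOrderAt Φ w

/-- `p` is the genus of the sequence `(z n)`: the least `k` such that `∑ |z n| ^ (-k)` diverges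
and `∑ |z n| ^ (-(k + 1))` converges. -/
def IsGenus (z : ℕ → ℂ) (p : ℕ) : Prop :=
  IsLeast {k : ℕ | ¬ Summable (fun n => (‖z n‖ ^ k)⁻¹) ∧
    Summable (fun n => (‖z n‖ ^ (k + 1))⁻¹)} p

/-- `Φ(w) = e^{a w} ∏ E_p(w / z n)` is the Hadamard factorization of `Φ`: `(z n)` is the sequence of
its zeros, `p` is the genus of that sequence, and the product converges to `e^{-a w} Φ(w)`. -/
structure IsHadamardFactorization (Φ : ℂ → ℂ) (a : ℂ) (p : ℕ) (z : ℕ → ℂ) : Prop where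
  zeros : IsZeroSequence Φ z
  genus : IsGenus z p
  multipliable : ∀ w, Multipliable fun n => canonicalFactor p (w / z n)
  eq_prod : ∀ w, Φ w = Complex.exp (a * w) * ∏' n, canonicalFactor p (w / z n)

end HypercyclicAlgebra

end

open Filter Topology

noncomputable section

namespace HypercyclicAlgebra

/-! All cases reduce to one dichotomy: `Φ(D)` has a hypercyclic algebra exactly when `Φ` is not of
the form `exp (a * z)`. A nonconstant symbol of subexponential growth is not an exponential, nor is
a symbol with a zero; a zero-free symbol of exponential type with `Φ 0 = 1` is one.

If `Φ = exp (a * z)`, then `Φ(D)` is translation by `a`, and the iterates of `f * f` are squares of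
entire functions. A square cannot be within distance 1 of `z` on the unit disc, since `z` has no
continuous square root on the circle.

Otherwise `log ‖Φ‖` is strictly convex and positive on a short ray along some `ω`
(`exists_strictConvexOn_ray`) and negative on one along some `ω'` (`exists_norm_lt_one_ray`).
Exponentials are eigenvectors, `Φ(D) e^{cz} = Φ(c) e^{cz}`, and those with exponents on a short ray
span a dense subspace. By Baire category it suffices, for each `m`, to find `u` near a given `A = ∑
a_s e^{sω'z}` with `T^N (u^m)` near a given `B = ∑ c_x e^{xωz}` and `T^N (u^i)` near 0 for `0 < i <
m`. Take `u = A + ∑ b_x k_x^N e^{(x/m)ωz}` with `b_x^m = c_x` and `k_x^m = 1 / Φ(xω)`. In the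
expansion of `u^i` the pure powers of degree `m` reproduce `B`. Every other term is multiplied by
the `N`-th power of a number of modulus less than 1: by strict Jensen on the first ray, by stability
of that inequality for mixed terms, and by `‖Φ‖ < 1` on the second ray for products of terms of `A`.
-/

/-- The algebra without unit generated by `u`, described by polynomials without constant term. -/
def polynomialAlgebra {X : Type*} [Ring X] [Algebra ℂ X] (u : X) : NonUnitalSubalgebra ℂ X where
  carrier := {x | ∃ P : Polynomial ℂ, P.coeff 0 = 0 ∧ Polynomial.aeval u P = x}
  add_mem' := by
    rintro _ _ ⟨P, hP, rfl⟩ ⟨Q, hQ, rfl⟩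
    exact ⟨P + Q, by simp [hP, hQ], by simp⟩
  zero_mem' := ⟨0, by simp, by simp⟩
  mul_mem' := by
    rintro _ _ ⟨P, hP, rfl⟩ ⟨Q, hQ, rfl⟩
    exact ⟨P * Q, by simp [Polynomial.mul_coeff_zero, hP], by simp⟩
  smul_mem' := by
    rintro c _ ⟨P, hP, rfl⟩
    exact ⟨c • P, by simp [hP], by simp⟩

/-- Isolates the top power: if its image is steered to a target while the images of the lower powers
tend to 0, the image of the whole polynomial is controlled. -/
theorem map_iterate_aeval {X : Type*} [Ring X] [Algebra ℂ X] (T : X →ₗ[ℂ] X)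
    (u : X) (N : ℕ) {P : Polynomial ℂ} (hP : P.coeff 0 = 0) :
    T^[N] (Polynomial.aeval u P) = P.leadingCoeff • T^[N] (u ^ P.natDegree) +
      ∑ i ∈ Finset.Ico 1 P.natDegree, P.coeff i • T^[N] (u ^ i) := by
  have h : ∀ x, T^[N] x = (T ^ N) x := fun x => by rw [Module.End.pow_apply]
  rcases Nat.eq_zero_or_pos P.natDegree with hd | hd
  · have hP0 : P = 0 := by
      rw [Polynomial.eq_C_of_natDegree_eq_zero hd, hP, Polynomial.C_0]
    simp [hP0, h]
  · simp only [h]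
    rw [Polynomial.aeval_eq_sum_range, Finset.sum_range_succ, map_add, map_sum,
      Finset.range_eq_Ico, Finset.sum_eq_sum_Ico_succ_bot hd, hP]
    simp [add_comm]

/-! ### Baire category criterion for hypercyclic algebras. -/

section Criterion

variable {X : Type*} [TopologicalSpace X] [Ring X] [Algebra ℂ X]

/-- A transitivity criterion for the existence of a hypercyclic algebra. -/
theorem hasHypercyclicAlgebra_of_transitive [IsTopologicalRing X] [ContinuousConstSMul ℂ X]
    [BaireSpace X] [SecondCountableTopology X] [T1Space X] [Nontrivial X]
    (T : X → X) (hlin : IsLinearMap ℂ T) (hT : Continuous T)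
    (h : ∀ m : ℕ, 0 < m → ∀ U V W : Set X, IsOpen U → U.Nonempty → IsOpen V → V.Nonempty →
      IsOpen W → (0 : X) ∈ W → ∃ u ∈ U, ∃ N : ℕ, T^[N] (u ^ m) ∈ V ∧
        ∀ i ∈ Finset.Ico 1 m, T^[N] (u ^ i) ∈ W) :
    HasHypercyclicAlgebra T := by
  set B := TopologicalSpace.countableBasis X with hB
  have hTN : ∀ N, Continuous (T^[N]) := fun N => hT.iterate N
  -- These sets are open, and dense by hypothesis when `0 ∈ W`. A generator common to all of them
  -- for basic `V`, `W` exists by Baire.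
  set G : ℕ → Set X → Set X → Set X := fun m V W =>
    ⋃ N : ℕ, {u | T^[N] (u ^ m) ∈ V ∧ ∀ i ∈ Finset.Ico 1 m, T^[N] (u ^ i) ∈ W} with hG
  have hGo : ∀ m, ∀ V ∈ B, ∀ W ∈ B, IsOpen (G m V W) := by
    intro m V hV W hW
    refine isOpen_iUnion fun N => ?_
    have h1 : IsOpen {u : X | T^[N] (u ^ m) ∈ V} :=
      (TopologicalSpace.isOpen_of_mem_countableBasis hV).preimage
        ((hTN N).comp (continuous_pow m))
    have h2 : IsOpen (⋂ i ∈ Finset.Ico 1 m, {u : X | T^[N] (u ^ i) ∈ W}) :=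
      isOpen_biInter_finset fun i _ =>
        (TopologicalSpace.isOpen_of_mem_countableBasis hW).preimage
          ((hTN N).comp (continuous_pow i))
    convert! h1.inter h2 using 1
    ext u
    simp
  have hGd : ∀ m, 0 < m → ∀ V ∈ B, ∀ W ∈ B, (0 : X) ∈ W → Dense (G m V W) := by
    intro m hm V hV W hW h0
    rw [dense_iff_inter_open]
    intro U hU hUne
    obtain ⟨u, hu, N, h1, h2⟩ := h m hm U V W hU hUne
      (TopologicalSpace.isOpen_of_mem_countableBasis hV)
      (TopologicalSpace.nonempty_of_mem_countableBasis hV)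
      (TopologicalSpace.isOpen_of_mem_countableBasis hW) h0
    exact ⟨u, hu, Set.mem_iUnion.2 ⟨N, h1, h2⟩⟩
  set S : Set (ℕ × Set X × Set X) :=
    {p | 0 < p.1 ∧ p.2.1 ∈ B ∧ p.2.2 ∈ B ∧ (0 : X) ∈ p.2.2} with hS
  have hBc : B.Countable := TopologicalSpace.countable_countableBasis X
  have hSc : S.Countable := by
    refine ((Set.countable_univ (α := ℕ)).prod (hBc.prod hBc)).mono ?_
    rintro ⟨m, V, W⟩ ⟨-, h2, h3, -⟩
    exact ⟨trivial, h2, h3⟩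
  have hdense : Dense (⋂ p ∈ S, G p.1 p.2.1 p.2.2) :=
    dense_biInter_of_isOpen (fun p hp => hGo _ _ hp.2.1 _ hp.2.2.1) hSc
      (fun p hp => hGd _ hp.1 _ hp.2.1 _ hp.2.2.1 hp.2.2.2)
  obtain ⟨u, hu⟩ := hdense.nonempty
  have hu' : ∀ m, 0 < m → ∀ V ∈ B, ∀ W ∈ B, (0 : X) ∈ W → ∃ N, T^[N] (u ^ m) ∈ V ∧
      ∀ i ∈ Finset.Ico 1 m, T^[N] (u ^ i) ∈ W := by
    intro m hm V hV W hW h0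
    have := Set.mem_iInter₂.1 hu (m, V, W) ⟨hm, hV, hW, h0⟩
    exact Set.mem_iUnion.1 this
  have hbasis := TopologicalSpace.isBasis_countableBasis X
  have key : ∀ P : Polynomial ℂ, P.coeff 0 = 0 → P ≠ 0 →
      IsHypercyclicVector T (Polynomial.aeval u P) := by
    intro P hP hP0
    have hd : 0 < P.natDegree := by
      rw [Nat.pos_iff_ne_zero]
      intro hd
      exact hP0 (by rw [Polynomial.eq_C_of_natDegree_eq_zero hd, hP, Polynomial.C_0])
    have hlc : P.leadingCoeff ≠ 0 := Polynomial.leadingCoeff_ne_zero.2 hP0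
    rw [IsHypercyclicVector, dense_iff_inter_open]
    rintro O hO ⟨v, hv⟩
    -- `F` recovers the image of `P(u)` from the images of the powers of `u`. It sends
    -- `(P.leadingCoeff⁻¹ • v, 0)` to `v`, so nearby inputs land in `O`.
    set F : X × (ℕ → X) → X := fun q =>
      P.leadingCoeff • q.1 + ∑ i ∈ Finset.Ico 1 P.natDegree, P.coeff i • q.2 i with hF
    have hFc : Continuous F := by
      refine (continuous_fst.const_smul _).add (continuous_finsetSum _ fun i _ => ?_)
      exact ((continuous_apply i).comp continuous_snd).const_smul _
    have hmem : F⁻¹' O ∈ 𝓝 (P.leadingCoeff⁻¹ • v, (0 : ℕ → X)) := by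
      refine hFc.continuousAt (hO.mem_nhds ?_)
      simpa [hF, smul_smul, hlc] using hv
    rw [nhds_prod_eq, mem_prod_iff] at hmem
    obtain ⟨V', hV', Y, hY, hVY⟩ := hmem
    obtain ⟨V, hVB, hvV, hVV'⟩ := hbasis.mem_nhds_iff.1 hV'
    -- A neighbourhood in the product restricts only finitely many coordinates; intersecting those
    -- restrictions gives one `W` serving all of them.
    have hWex : ∃ W ∈ B, (0 : X) ∈ W ∧ ∀ z : ℕ → X,
        (∀ i ∈ Finset.Ico 1 P.natDegree, z i ∈ W) →
        (∀ i ∉ Finset.Ico 1 P.natDegree, z i = 0) → z ∈ Y := by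
      rw [nhds_pi, Filter.mem_pi] at hY
      obtain ⟨I, hI, t, ht, htY⟩ := hY
      have : (⋂ i ∈ I, t i) ∈ 𝓝 (0 : X) := (biInter_mem hI).2 fun i _ => ht i
      obtain ⟨W, hWB, h0W, hW⟩ := hbasis.mem_nhds_iff.1 this
      refine ⟨W, hWB, h0W, fun z h1 h2 => htY fun i hi => ?_⟩
      by_cases hi' : i ∈ Finset.Ico 1 P.natDegree
      · exact Set.mem_iInter₂.1 (hW (h1 i hi')) i hi
      · rw [h2 i hi']
        exact mem_of_mem_nhds (ht i)
    obtain ⟨W, hWB, h0W, hW⟩ := hWex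
    obtain ⟨N, hN1, hN2⟩ := hu' P.natDegree hd V hVB W hWB h0W
    refine ⟨T^[N] (Polynomial.aeval u P), ?_, ⟨N, rfl⟩⟩
    classical
    have hz := hW (fun i => if i ∈ Finset.Ico 1 P.natDegree then T^[N] (u ^ i) else 0)
      (fun i hi => by simpa only [if_pos hi] using hN2 i hi) (fun i hi => if_neg hi)
    have := hVY (Set.mk_mem_prod (hVV' hN1) hz)
    have hsum : F (T^[N] (u ^ P.natDegree),
        fun i => if i ∈ Finset.Ico 1 P.natDegree then T^[N] (u ^ i) else 0) =
        P.leadingCoeff • T^[N] (u ^ P.natDegree) +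
          ∑ i ∈ Finset.Ico 1 P.natDegree, P.coeff i • T^[N] (u ^ i) := by
      simp only [hF]
      congr 1
      exact Finset.sum_congr rfl fun i hi => by rw [if_pos hi]
    have hexp := map_iterate_aeval (hlin.mk' T) u N hP
    rw [show ⇑(hlin.mk' T) = T from rfl] at hexp
    rw [hexp, ← hsum]
    exact this
  have hX : Polynomial.aeval u (Polynomial.X : Polynomial ℂ) = u := by simp
  have hu0 : u ≠ 0 := by
    have hd := key Polynomial.X (by simp) Polynomial.X_ne_zero
    rw [hX] at hd
    rintro rfl
    obtain ⟨x, hx⟩ := exists_ne (0 : X)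
    obtain ⟨_, hy1, N, rfl⟩ := dense_iff_inter_open.1 hd {0}ᶜ isOpen_compl_singleton ⟨x, hx⟩
    refine hy1 ?_
    change T^[N] 0 = 0
    exact Function.iterate_fixed hlin.map_zero N
  refine ⟨polynomialAlgebra u, fun hbot => ?_, ?_⟩
  · have hmem : u ∈ polynomialAlgebra u := ⟨Polynomial.X, by simp, hX⟩
    rw [hbot] at hmem
    exact hu0 (NonUnitalAlgebra.mem_bot.1 hmem)
  · rintro _ ⟨P, hP, rfl⟩ hne
    exact key P hP (by rintro rfl; simp at hne)

end Criterion

/-! ### The topology of `H(ℂ)`: completeness, Baire property, convergence on discs. -/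

theorem isClosed_entireFunctions : IsClosed (entireFunctions : Set C(ℂ, ℂ)) := by
  refine isClosed_of_closure_subset fun f hf => ?_
  have := mem_closure_iff_nhdsWithin_neBot.1 hf
  have ht : Tendsto id (𝓝[(entireFunctions : Set C(ℂ, ℂ))] f) (𝓝 f) :=
    tendsto_id.mono_left nhdsWithin_le_nhds
  rw [ContinuousMap.tendsto_iff_tendstoLocallyUniformly] at ht
  have h2 := (tendstoLocallyUniformlyOn_univ.2 ht).differentiableOn (U := Set.univ) ?_ isOpen_univ
  · exact differentiableOn_univ.1 h2
  · filter_upwards [self_mem_nhdsWithin] with g hg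
    exact Differentiable.differentiableOn hg

instance : CompleteSpace entireFunctions := isClosed_entireFunctions.completeSpace_coe

instance : BaireSpace entireFunctions := by
  let _ : PseudoMetricSpace C(ℂ, ℂ) := UniformSpace.pseudoMetricSpace C(ℂ, ℂ)
  let _ : PseudoMetricSpace entireFunctions :=
    PseudoMetricSpace.induced ((↑) : entireFunctions → C(ℂ, ℂ)) inferInstance
  infer_instance

instance : SecondCountableTopology entireFunctions :=
  TopologicalSpace.Subtype.secondCountableTopology (entireFunctions : Set C(ℂ, ℂ))

instance : IsTopologicalRing entireFunctions where
  continuous_add := ((continuous_subtype_val.comp continuous_fst).add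
    (continuous_subtype_val.comp continuous_snd)).subtype_mk _
  continuous_mul := ((continuous_subtype_val.comp continuous_fst).mul
    (continuous_subtype_val.comp continuous_snd)).subtype_mk _
  continuous_neg := (continuous_subtype_val.neg).subtype_mk _

theorem tendsto_iff {ι : Type*} {l : Filter ι} {F : ι → entireFunctions} {f : entireFunctions} :
    Tendsto F l (𝓝 f) ↔ ∀ R : ℝ, 0 < R → ∀ ε : ℝ, 0 < ε →
      ∀ᶠ i in l, ∀ z : ℂ, ‖z‖ ≤ R → ‖(F i).1 z - f.1 z‖ < ε := by
  rw [tendsto_subtype_rng, ContinuousMap.tendsto_iff_forall_isCompact_tendstoUniformlyOn]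
  constructor
  · intro h R hR ε hε
    filter_upwards [Metric.tendstoUniformlyOn_iff.1
      (h _ (isCompact_closedBall (0 : ℂ) R)) ε hε] with i hi z hz
    have := hi z (by simpa using hz)
    rwa [dist_comm, dist_eq_norm] at this
  · intro h K hK
    rw [Metric.tendstoUniformlyOn_iff]
    intro ε hε
    obtain ⟨R, hR, hKR⟩ := hK.isBounded.subset_closedBall_lt 0 0
    filter_upwards [h R hR ε hε] with i hi z hz
    rw [dist_comm, dist_eq_norm]
    exact hi z (by simpa using hKR hz)

theorem exists_norm_le (f : entireFunctions) (R : ℝ) :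
    ∃ C : ℝ, 0 ≤ C ∧ ∀ z : ℂ, ‖z‖ ≤ R → ‖f.1 z‖ ≤ C := by
  obtain ⟨C, hC⟩ := (isCompact_closedBall (0 : ℂ) R).exists_bound_of_continuousOn
    f.1.continuous.continuousOn
  exact ⟨max C 0, le_max_right _ _, fun z hz => (hC z (by simpa using hz)).trans (le_max_left _ _)⟩

/-! ### Convolution operators -/

theorem coe_diffOp_pow (n : ℕ) (f : entireFunctions) :
    ((diffOp ^ n) f).1 = iteratedDeriv n (f : C(ℂ, ℂ)) := by
  induction n with
  | zero => simp
  | succ n ih =>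
    rw [pow_succ', iteratedDeriv_succ, ← ih]
    rfl

/-- Cauchy's estimate on the circle of radius `r` about `z`, which stays inside the disc of radius
`R + r`. -/
theorem norm_diffOp_pow_le (n : ℕ) (f : entireFunctions) {R r C : ℝ} (hr : 0 < r)
    (hC : ∀ z : ℂ, ‖z‖ ≤ R + r → ‖f.1 z‖ ≤ C) {z : ℂ} (hz : ‖z‖ ≤ R) :
    ‖((diffOp ^ n) f).1 z‖ ≤ n.factorial * C / r ^ n := by
  have := Complex.norm_iteratedDeriv_le_of_forall_mem_sphere_norm_le n hr (c := z) (C := C)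
    (Differentiable.diffContOnCl (f.2 : Differentiable ℂ f.1)) fun w hw => hC w ?_
  · rw [← coe_diffOp_pow] at this
    exact this
  · have : ‖w - z‖ = r := by simpa using hw
    calc ‖w‖ = ‖z + (w - z)‖ := by ring_nf
      _ ≤ ‖z‖ + ‖w - z‖ := norm_add_le _ _
      _ ≤ R + r := by linarith

/-- The derivatives of `Φ` at the origin grow at most geometrically. For an entire function this
says that `Φ` is of exponential type. -/
def HasGeometricDerivBound (Φ : ℂ → ℂ) (C τ : ℝ) : Prop :=
  0 ≤ C ∧ 0 < τ ∧ ∀ n, ‖iteratedDeriv n Φ 0‖ ≤ C * τ ^ n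

/-- The `n`-th term of the series defining `convolutionOp Φ f`. -/
def convolutionTerm (Φ : ℂ → ℂ) (f : entireFunctions) (n : ℕ) : entireFunctions :=
  (iteratedDeriv n Φ 0 / (n.factorial : ℂ)) • (diffOp ^ n) f

namespace HasGeometricDerivBound

variable {Φ : ℂ → ℂ} {C τ : ℝ}

/-- Cauchy's estimate at radius `2 * τ` turns the factor `τ ^ n` into a ratio of `1 / 2`, and its
factorial cancels the one in the Taylor coefficient. -/
theorem norm_convolutionTerm_le (h : HasGeometricDerivBound Φ C τ) (f : entireFunctions) (n : ℕ)
    {R M : ℝ} (hM : ∀ z : ℂ, ‖z‖ ≤ R + 2 * τ → ‖f.1 z‖ ≤ M) {z : ℂ} (hz : ‖z‖ ≤ R) :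
    ‖(convolutionTerm Φ f n).1 z‖ ≤ C * M * (1 / 2) ^ n := by
  obtain ⟨hC, hτ, hΦ⟩ := h
  have h1 := norm_diffOp_pow_le n f (by positivity : 0 < 2 * τ) hM hz
  have hM0 : 0 ≤ M := (norm_nonneg _).trans (hM z (by linarith))
  have hn : (0 : ℝ) < n.factorial := by exact_mod_cast n.factorial_pos
  change ‖(iteratedDeriv n Φ 0 / (n.factorial : ℂ)) * ((diffOp ^ n) f).1 z‖ ≤ _
  rw [norm_mul, norm_div, Complex.norm_natCast]
  calc ‖iteratedDeriv n Φ 0‖ / n.factorial * ‖((diffOp ^ n) f).1 z‖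
      ≤ (C * τ ^ n) / n.factorial * (n.factorial * M / (2 * τ) ^ n) := by
        gcongr
        exact hΦ n
    _ = C * M * (1 / 2) ^ n := by
        rw [mul_pow, one_div, inv_pow]
        field_simp

theorem summable_convolutionTerm (h : HasGeometricDerivBound Φ C τ) (f : entireFunctions) :
    Summable (convolutionTerm Φ f) := by
  have hs : Summable fun n => (convolutionTerm Φ f n).1 := by
    refine ContinuousMap.summable_of_locally_summable_norm fun K => ?_
    obtain ⟨R, hR, hKR⟩ := K.isCompact.isBounded.subset_closedBall_lt 0 0
    obtain ⟨M, hM0, hM⟩ := exists_norm_le f (R + 2 * τ)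
    refine Summable.of_nonneg_of_le (fun _ => norm_nonneg _) (fun n => ?_)
      ((summable_geometric_two).mul_left (C * M))
    rw [ContinuousMap.norm_le _ (by have := h.1; positivity)]
    intro z
    exact h.norm_convolutionTerm_le f n hM (by simpa using hKR z.2)
  obtain ⟨g, hg⟩ := hs
  have hgm : g ∈ entireFunctions := by
    refine isClosed_entireFunctions.mem_of_tendsto hg (Eventually.of_forall fun s => ?_)
    exact sum_mem fun n _ => (convolutionTerm Φ f n).2
  refine ⟨⟨g, hgm⟩, ?_⟩
  rw [HasSum, tendsto_subtype_rng]
  refine hg.congr fun s => ?_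
  simp

theorem hasSum_convolutionTerm (h : HasGeometricDerivBound Φ C τ) (f : entireFunctions) :
    HasSum (convolutionTerm Φ f) (convolutionOp Φ f) :=
  (h.summable_convolutionTerm f).hasSum

theorem hasSum_convolutionOp_apply (h : HasGeometricDerivBound Φ C τ) (f : entireFunctions)
    (z : ℂ) :
    HasSum (fun n => iteratedDeriv n Φ 0 / (n.factorial : ℂ) * iteratedDeriv n f.1 z)
      ((convolutionOp Φ f).1 z) := by
  have h1 := (h.hasSum_convolutionTerm f).map entireFunctions.val continuous_subtype_val
  have h2 := ContinuousMap.hasSum_apply h1 z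
  convert! h2 using 2 with n
  rw [← coe_diffOp_pow]
  rfl

theorem norm_convolutionOp_le (h : HasGeometricDerivBound Φ C τ) (f : entireFunctions)
    {R M : ℝ} (hM : ∀ z : ℂ, ‖z‖ ≤ R + 2 * τ → ‖f.1 z‖ ≤ M) {z : ℂ} (hz : ‖z‖ ≤ R) :
    ‖(convolutionOp Φ f).1 z‖ ≤ C * M * 2 := by
  have h1 := h.hasSum_convolutionOp_apply f z
  rw [← h1.tsum_eq]
  refine tsum_of_norm_bounded (hasSum_geometric_two.mul_left (C * M)) fun n => ?_
  have := h.norm_convolutionTerm_le f n hM hz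
  rw [← coe_diffOp_pow]
  exact this

/-- The convolution operator with symbol `Φ` as a linear map. -/
def linearMap (h : HasGeometricDerivBound Φ C τ) : entireFunctions →ₗ[ℂ] entireFunctions where
  toFun := convolutionOp Φ
  map_add' f g := by
    refine (h.hasSum_convolutionTerm _).unique ?_
    convert! (h.hasSum_convolutionTerm f).add (h.hasSum_convolutionTerm g) using 2 with n
    simp [convolutionTerm]
  map_smul' c f := by
    refine (h.hasSum_convolutionTerm _).unique ?_
    convert! (h.hasSum_convolutionTerm f).const_smul c using 2 with n
    simp [convolutionTerm, smul_comm c]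

theorem continuous_linearMap (h : HasGeometricDerivBound Φ C τ) : Continuous h.linearMap := by
  rw [continuous_iff_continuousAt]
  intro f
  rw [ContinuousAt, tendsto_iff]
  intro R hR ε hε
  obtain ⟨hC, hτ, -⟩ := id h
  -- The `+ 1` in the denominator covers `C = 0` and makes the final inequality strict.
  have := tendsto_iff.1 (tendsto_id (x := 𝓝 f)) (R + 2 * τ) (by positivity)
    (ε / (C * 2 + 1)) (by positivity)
  filter_upwards [this] with g hg z hz
  have hsub : ∀ w, (g + (-1 : ℂ) • f).1 w = g.1 w - f.1 w := fun w => by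
    change g.1 w + -1 * f.1 w = _
    ring
  have h1 := h.norm_convolutionOp_le (g + (-1 : ℂ) • f) (M := ε / (C * 2 + 1))
    (fun w hw => by rw [hsub]; exact (hg w hw).le) hz
  have h2 : (convolutionOp Φ (g + (-1 : ℂ) • f)).1 z =
      (h.linearMap g).1 z - (h.linearMap f).1 z := by
    change (h.linearMap (g + (-1 : ℂ) • f)).1 z = _
    rw [map_add, map_smul]
    change (h.linearMap g).1 z + -1 * (h.linearMap f).1 z = _
    ring
  rw [h2] at h1
  refine h1.trans_lt ?_
  rw [mul_comm C, mul_assoc, div_mul_eq_mul_div, div_lt_iff₀ (by positivity)]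
  nlinarith

end HasGeometricDerivBound

/-! ### Exponentials -/

/-- The entire function `z ↦ exp (c * z)`. -/
def expFun (c : ℂ) : entireFunctions :=
  ⟨⟨fun z => Complex.exp (c * z), by fun_prop⟩,
    show Differentiable ℂ fun z => Complex.exp (c * z) by fun_prop⟩

@[simp] theorem expFun_apply (c z : ℂ) : (expFun c).1 z = Complex.exp (c * z) := rfl

theorem expFun_zero : expFun 0 = 1 := by
  refine Subtype.ext (ContinuousMap.ext fun z => ?_)
  rw [expFun_apply, zero_mul, Complex.exp_zero]
  rfl

theorem expFun_add (c d : ℂ) : expFun (c + d) = expFun c * expFun d := by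
  refine Subtype.ext (ContinuousMap.ext fun z => ?_)
  rw [expFun_apply, add_mul, Complex.exp_add]
  rfl

theorem prod_expFun {ι : Type*} (s : Finset ι) (c : ι → ℂ) :
    ∏ i ∈ s, expFun (c i) = expFun (∑ i ∈ s, c i) := by
  classical
  induction s using Finset.induction_on with
  | empty => simp [expFun_zero]
  | insert i s hi ih => rw [Finset.prod_insert hi, Finset.sum_insert hi, expFun_add, ih]

/-- Each `D` contributes a factor `c`, so the series sums to the Taylor expansion of `Φ` at `c`. -/
theorem HasGeometricDerivBound.convolutionOp_expFun {Φ : ℂ → ℂ} {C τ : ℝ}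
    (h : HasGeometricDerivBound Φ C τ) (hΦ : Differentiable ℂ Φ) (c : ℂ) :
    convolutionOp Φ (expFun c) = Φ c • expFun c := by
  refine Subtype.ext (ContinuousMap.ext fun z => ?_)
  refine (h.hasSum_convolutionOp_apply (expFun c) z).unique ?_
  have h1 := (Complex.hasSum_taylorSeries_of_entire hΦ 0 c).mul_right (Complex.exp (c * z))
  refine HasSum.congr_fun h1 fun n => ?_
  change iteratedDeriv n Φ 0 / (n.factorial : ℂ) *
    iteratedDeriv n (fun z => Complex.exp (c * z)) z = _
  rw [iteratedDeriv_cexp_const_mul]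
  simp only [sub_zero, smul_eq_mul]
  ring

/-- The entire function `z ↦ z ^ n`. -/
def monomialFun (n : ℕ) : entireFunctions :=
  ⟨⟨fun z => z ^ n, by fun_prop⟩, show Differentiable ℂ fun z : ℂ => z ^ n by fun_prop⟩

theorem mem_closure_span_monomialFun (f : entireFunctions) {M : Submodule ℂ entireFunctions}
    (hM : IsClosed (M : Set entireFunctions)) (h : ∀ n, monomialFun n ∈ M) : f ∈ M := by
  have hf : Differentiable ℂ f.1 := f.2
  set F : ℕ → entireFunctions := fun n =>
    (iteratedDeriv n f.1 0 / (n.factorial : ℂ)) • monomialFun n with hF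
  have happly : ∀ n z, (F n).1 z = iteratedDeriv n f.1 0 / (n.factorial : ℂ) * z ^ n :=
    fun n z => rfl
  have hs : Summable fun n => (F n).1 := by
    refine ContinuousMap.summable_of_locally_summable_norm fun K => ?_
    obtain ⟨R, hR, hKR⟩ := K.isCompact.isBounded.subset_closedBall_lt 0 0
    obtain ⟨C, hC0, hC⟩ := exists_norm_le f (0 + 2 * R)
    refine Summable.of_nonneg_of_le (fun _ => norm_nonneg _) (fun n => ?_)
      ((summable_geometric_two).mul_left C)
    rw [ContinuousMap.norm_le _ (by positivity)]
    intro z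
    have hz : ‖(z : ℂ)‖ ≤ R := by simpa using hKR z.2
    have h1 := norm_diffOp_pow_le n f (by positivity : 0 < 2 * R) hC (z := 0) (by simp)
    rw [coe_diffOp_pow] at h1
    have hn : (0 : ℝ) < n.factorial := by exact_mod_cast n.factorial_pos
    change ‖(F n).1 z‖ ≤ _
    rw [happly, norm_mul, norm_div, norm_pow, Complex.norm_natCast]
    calc ‖iteratedDeriv n f.1 0‖ / n.factorial * ‖(z : ℂ)‖ ^ n
        ≤ (n.factorial * C / (2 * R) ^ n) / n.factorial * R ^ n := by gcongr
      _ = C * (1 / 2) ^ n := by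
          rw [mul_pow, one_div, inv_pow]
          field_simp
  obtain ⟨g, hg⟩ := hs
  have hgf : g = f.1 := by
    ext z
    refine (ContinuousMap.hasSum_apply hg z).unique ?_
    refine (Complex.hasSum_taylorSeries_of_entire hf 0 z).congr_fun fun n => ?_
    rw [happly]
    simp only [sub_zero, smul_eq_mul]
    ring
  have hsum : HasSum F f := by
    rw [HasSum, tendsto_subtype_rng, ← hgf]
    refine hg.congr fun s => ?_
    simp
  exact hM.mem_of_tendsto hsum (Eventually.of_forall fun s =>
    M.sum_mem fun n _ => M.smul_mem _ (h n))

/-- By strong induction the lower Taylor terms of `e^{sωz}` already lie in `M`. Subtracting them,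
dividing by `(sω)^n / n!` and letting `s → 0+` leaves `z^n`. -/
theorem monomialFun_mem {ω : ℂ} (hω : ω ≠ 0) {η : ℝ} (hη : 0 < η)
    {M : Submodule ℂ entireFunctions} (hM : IsClosed (M : Set entireFunctions))
    (h : ∀ s ∈ Set.Ioo 0 η, expFun ((s : ℝ) * ω) ∈ M) (n : ℕ) : monomialFun n ∈ M := by
  induction n using Nat.strong_induction_on with
  | _ n ih =>
  set F : ℝ → entireFunctions := fun s => ((n.factorial : ℂ) * (((s : ℂ) * ω) ^ n)⁻¹) •
    (expFun (s * ω) + (-1 : ℂ) • ∑ k ∈ Finset.range n, (((s : ℂ) * ω) ^ k / (k.factorial : ℂ)) •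
      monomialFun k) with hF
  have hlim : Tendsto F (𝓝[>] 0) (𝓝 (monomialFun n)) := by
    rw [tendsto_iff]
    intro R hR ε hε
    -- This is the remainder bound for the exponential series after division by `‖sω‖^n / n!`.
    have hb : Tendsto (fun s : ℝ => n.factorial * (‖(s : ℂ) * ω‖ * R ^ (n + 1) *
        Real.exp (‖(s : ℂ) * ω‖ * R))) (𝓝[>] 0) (𝓝 0) := by
      refine Tendsto.mono_left ?_ nhdsWithin_le_nhds
      have : Continuous fun s : ℝ => n.factorial * (‖(s : ℂ) * ω‖ * R ^ (n + 1) *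
        Real.exp (‖(s : ℂ) * ω‖ * R)) := by fun_prop
      simpa using this.tendsto 0
    filter_upwards [hb.eventually (gt_mem_nhds hε), self_mem_nhdsWithin] with s hs hs0 z hz
    refine lt_of_le_of_lt ?_ hs
    have hs0' : (s : ℂ) * ω ≠ 0 := mul_ne_zero (by exact_mod_cast (ne_of_gt hs0)) hω
    have hn : (n.factorial : ℂ) ≠ 0 := by exact_mod_cast n.factorial_ne_zero
    have hval : (F s).1 z = ((n.factorial : ℂ) * (((s : ℂ) * ω) ^ n)⁻¹) *
        (Complex.exp (s * ω * z) -
          ∑ k ∈ Finset.range n, (((s : ℂ) * ω) ^ k / (k.factorial : ℂ)) * z ^ k) := by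
      simp only [hF]
      change _ * ((expFun (s * ω)).1 z +
        -1 * (entireFunctions.val (∑ k ∈ Finset.range n, _)) z) = _
      rw [map_sum, ContinuousMap.sum_apply, neg_one_mul, ← sub_eq_add_neg]
      rfl
    have hsplit : (F s).1 z - (monomialFun n).1 z =
        ((n.factorial : ℂ) * (((s : ℂ) * ω) ^ n)⁻¹) * (Complex.exp (s * ω * z) -
          ∑ k ∈ Finset.range (n + 1), (s * ω * z) ^ k / (k.factorial : ℂ)) := by
      rw [hval, Finset.sum_range_succ, ← sub_sub, mul_sub _ _ ((s * ω * z) ^ n / _)]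
      congr 1
      · congr 2
        exact Finset.sum_congr rfl fun k _ => by rw [mul_pow (↑s * ω) z]; ring
      · change z ^ n = _
        rw [mul_pow (↑s * ω) z]
        field_simp
    rw [hsplit, norm_mul, norm_mul, norm_inv, norm_pow, Complex.norm_natCast, mul_assoc]
    refine mul_le_mul_of_nonneg_left ?_ (Nat.cast_nonneg _)
    have hw : 0 < ‖(s : ℂ) * ω‖ := norm_pos_iff.2 hs0'
    calc (‖(s : ℂ) * ω‖ ^ n)⁻¹ * ‖Complex.exp (s * ω * z) -
          ∑ k ∈ Finset.range (n + 1), (s * ω * z) ^ k / (k.factorial : ℂ)‖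
        ≤ (‖(s : ℂ) * ω‖ ^ n)⁻¹ * (‖s * ω * z‖ ^ (n + 1) * Real.exp ‖s * ω * z‖) := by
          gcongr
          exact Complex.norm_exp_sub_sum_le_norm_mul_exp _ _
      _ = ‖(s : ℂ) * ω‖ * ‖z‖ ^ (n + 1) * Real.exp (‖(s : ℂ) * ω‖ * ‖z‖) := by
          rw [norm_mul (s * ω), mul_pow, pow_succ ‖(s : ℂ) * ω‖]
          field_simp
      _ ≤ _ := by gcongr
  refine hM.mem_of_tendsto hlim ?_
  filter_upwards [Ioo_mem_nhdsGT hη] with s hs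
  exact M.smul_mem _ (M.add_mem (h s hs) (M.smul_mem _ (M.sum_mem fun k hk =>
    M.smul_mem _ (ih k (Finset.mem_range.1 hk)))))

theorem expFun_combination_dense {ω : ℂ} (hω : ω ≠ 0) {η : ℝ} (hη : 0 < η)
    {U : Set entireFunctions} (hU : IsOpen U) (hne : U.Nonempty) :
    ∃ (L : Finset ℝ) (a : ℝ → ℂ), (∀ s ∈ L, s ∈ Set.Ioo 0 η) ∧
      ∑ s ∈ L, a s • expFun (s * ω) ∈ U := by
  set M : Submodule ℂ entireFunctions :=
    Submodule.span ℂ ((fun s : ℝ => expFun (s * ω)) '' Set.Ioo 0 η) with hMdef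
  have hcl : ∀ f : entireFunctions, f ∈ M.topologicalClosure := fun f =>
    mem_closure_span_monomialFun f M.isClosed_topologicalClosure
      (monomialFun_mem hω hη M.isClosed_topologicalClosure fun s hs =>
        M.le_topologicalClosure (Submodule.subset_span ⟨s, hs, rfl⟩))
  obtain ⟨f, hf⟩ := hne
  obtain ⟨g, hgU, hgM⟩ := mem_closure_iff.1 (hcl f) U hU hf
  obtain ⟨c, hc, rfl⟩ := (Finsupp.mem_span_image_iff_linearCombination ℂ).1 hgM
  exact ⟨c.support, c, fun s hs => hc hs, hgU⟩

/-! ### Local behaviour of the symbol near the origin -/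

theorem eventually_eq_of_deriv_eventually_eq_zero {f : ℂ → ℂ} {c : ℂ} (hf : AnalyticAt ℂ f c)
    (h : ∀ᶠ z in 𝓝 c, deriv f z = 0) : ∀ᶠ z in 𝓝 c, f z = f c := by
  obtain ⟨r, hr, hball⟩ := Metric.eventually_nhds_iff_ball.1 (hf.eventually_analyticAt.and h)
  filter_upwards [Metric.ball_mem_nhds c hr] with z hz
  exact Metric.isOpen_ball.is_const_of_deriv_eq_zero (convex_ball c r).isPreconnected
    (fun w hw => (hball w hw).1.differentiableAt.differentiableWithinAt)
    (fun w hw => (hball w hw).2) hz (Metric.mem_ball_self hr)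

/-- Among the rotations of `w` by the `k`-th roots of unity, one lies in the right half-plane. -/
theorem exists_rootOfUnity_mul_re_nonneg {k : ℕ} (hk : 1 < k) (w : ℂ) :
    ∃ ζ : ℂ, ζ ^ k = 1 ∧ 0 ≤ (ζ * w).re := by
  have hζ := Complex.isPrimitiveRoot_exp k (by omega)
  set ζ := Complex.exp (2 * Real.pi * Complex.I / k)
  by_contra! hcon
  have hneg : ∀ i ∈ Finset.range k, (ζ ^ i * w).re < 0 := fun i _ => by
    refine hcon _ ?_
    rw [← pow_mul, mul_comm, pow_mul, hζ.pow_eq_one, one_pow]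
  have hsum : ∑ i ∈ Finset.range k, (ζ ^ i * w).re = 0 := by
    rw [← Complex.re_sum, ← Finset.sum_mul, hζ.geom_sum_eq_zero hk, zero_mul, Complex.zero_re]
  have := Finset.sum_neg hneg ⟨0, Finset.mem_range.2 (by omega)⟩
  linarith

section Symbol

variable {Φ : ℂ → ℂ}

theorem analyticAt_log_symbol (hΦ : Differentiable ℂ Φ) (h0 : Φ 0 = 1) :
    AnalyticAt ℂ (fun z => Complex.log (Φ z)) 0 :=
  (hΦ.analyticAt 0).clog (by rw [h0]; exact Complex.one_mem_slitPlane)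

theorem eq_exp_of_log_eventually_linear (hΦ : Differentiable ℂ Φ) (h0 : Φ 0 = 1) {a : ℂ}
    (h : ∀ᶠ z in 𝓝 0, Complex.log (Φ z) = a * z) : ∀ z, Φ z = Complex.exp (a * z) := by
  have hne : ∀ᶠ z in 𝓝 (0 : ℂ), Φ z ≠ 0 :=
    hΦ.continuous.continuousAt.eventually_ne (by rw [h0]; exact one_ne_zero)
  have hev : Φ =ᶠ[𝓝 0] fun z => Complex.exp (a * z) := by
    filter_upwards [h, hne] with z hz hz0
    rw [← hz, Complex.exp_log hz0]
  have h1 : AnalyticOnNhd ℂ Φ Set.univ := fun z _ => hΦ.analyticAt z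
  have h2 : AnalyticOnNhd ℂ (fun z => Complex.exp (a * z)) Set.univ := fun z _ =>
    Differentiable.analyticAt (by fun_prop) z
  exact fun z => congrFun (h1.eq_of_eventuallyEq h2 hev) z

/-- If the second derivative of `log Φ` vanished near 0, `log Φ` would be linear there, and the
identity theorem would make `Φ` an exponential. -/
theorem not_eventually_deriv_deriv_log_eq_zero (hΦ : Differentiable ℂ Φ) (h0 : Φ 0 = 1)
    (hne : ¬ ∃ a : ℂ, ∀ z, Φ z = Complex.exp (a * z)) :
    ¬ ∀ᶠ z in 𝓝 0, deriv (deriv fun z => Complex.log (Φ z)) z = 0 := by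
  intro h
  have hψ := analyticAt_log_symbol hΦ h0
  set ψ := fun z => Complex.log (Φ z) with hψdef
  have h1 := eventually_eq_of_deriv_eventually_eq_zero hψ.deriv h
  refine hne ⟨deriv ψ 0, eq_exp_of_log_eventually_linear hΦ h0 ?_⟩
  have hlin : AnalyticAt ℂ (fun z => ψ z - deriv ψ 0 * z) 0 :=
    hψ.sub (analyticAt_const.mul analyticAt_id)
  have h2 := eventually_eq_of_deriv_eventually_eq_zero hlin ?_
  · filter_upwards [h2] with z hz
    have h00 : ψ 0 = 0 := by simp [hψdef, h0]
    rw [h00, mul_zero, sub_zero, sub_eq_zero] at hz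
    exact hz
  · filter_upwards [h1, hψ.eventually_analyticAt] with z hz hza
    have hd : HasDerivAt (fun z => ψ z - deriv ψ 0 * z) (deriv ψ z - deriv ψ 0 * 1) z :=
      hza.differentiableAt.hasDerivAt.sub ((hasDerivAt_id z).const_mul _)
    rw [hd.deriv, hz]
    ring

theorem hasDerivAt_re_comp_ray {f : ℂ → ℂ} {f' ω : ℂ} {t : ℝ} (hf : HasDerivAt f f' (t * ω)) :
    HasDerivAt (fun t : ℝ => (f (t * ω)).re) (f' * ω).re t := by
  have h1 : HasDerivAt (fun z : ℂ => z * ω) ω (t : ℂ) := by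
    simpa using (hasDerivAt_id (t : ℂ)).mul_const ω
  exact (HasDerivAt.comp (t : ℂ) hf h1).real_of_complex

theorem tendsto_ray (ω : ℂ) : Tendsto (fun t : ℝ => (t : ℂ) * ω) (𝓝 0) (𝓝 0) := by
  have : Continuous fun t : ℝ => (t : ℂ) * ω := by fun_prop
  simpa using this.tendsto 0

/-- On some ray issuing from the origin, `log ‖Φ‖` is strictly convex and positive. -/
theorem exists_strictConvexOn_ray (hΦ : Differentiable ℂ Φ) (h0 : Φ 0 = 1)
    (hne : ¬ ∃ a : ℂ, ∀ z, Φ z = Complex.exp (a * z)) :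
    ∃ ω : ℂ, ω ≠ 0 ∧ ∃ δ : ℝ, 0 < δ ∧
      StrictConvexOn ℝ (Set.Icc 0 δ) (fun t : ℝ => Real.log ‖Φ (t * ω)‖) ∧
      ∀ t ∈ Set.Ioc 0 δ, 1 < ‖Φ ((t : ℝ) * ω)‖ := by
  have hψ := analyticAt_log_symbol hΦ h0
  have hnot := not_eventually_deriv_deriv_log_eq_zero hΦ h0 hne
  have hre : ∀ z, Real.log ‖Φ z‖ = (Complex.log (Φ z)).re := fun z => (Complex.log_re _).symm
  simp only [hre]
  have hlog0 : Complex.log (Φ 0) = 0 := by rw [h0, Complex.log_one]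
  set ψ := fun z => Complex.log (Φ z) with hψdef
  obtain ⟨j, g, hg, hg0, hgeq⟩ :=
    hψ.deriv.deriv.exists_eventuallyEq_pow_smul_nonzero_iff.2 hnot
  -- With `ψ'' = z^j g` near 0, the second derivative of `ψ(tω)` is `t^j ω^(j+2) g(tω)`. Taking
  -- `ω^(j+2) = 1 / g 0` gives it positive real part for small `t > 0`. The leftover root of unity
  -- is used to make the initial slope nonnegative.
  obtain ⟨ω₀, hω₀⟩ := IsAlgClosed.exists_pow_nat_eq (g 0)⁻¹ (n := j + 2) (by omega)
  obtain ⟨ζ, hζ, hre0⟩ := exists_rootOfUnity_mul_re_nonneg (k := j + 2) (by omega)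
    (ω₀ * deriv ψ 0)
  set ω := ζ * ω₀ with hω
  have hωk : ω ^ (j + 2) * g 0 = 1 := by
    rw [hω, mul_pow, hζ, one_mul, hω₀, inv_mul_cancel₀ hg0]
  have hω0 : ω ≠ 0 := by
    intro h
    rw [h] at hωk
    simp at hωk
  have hpos : ∀ᶠ z in 𝓝 (0 : ℂ), 0 < (ω ^ (j + 2) * g z).re := by
    have : ContinuousAt (fun z => (ω ^ (j + 2) * g z).re) 0 :=
      Complex.continuous_re.continuousAt.comp (continuousAt_const.mul hg.continuousAt)
    refine this.eventually (lt_mem_nhds ?_)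
    simp [hωk]
  obtain ⟨r, hr, hball⟩ := Metric.eventually_nhds_iff_ball.1
    ((tendsto_ray ω).eventually (hψ.eventually_analyticAt.and (hgeq.and hpos)))
  have hmem : ∀ t ∈ Set.Icc 0 (r / 2), t ∈ Metric.ball (0 : ℝ) r := fun t ht => by
    rw [Metric.mem_ball, dist_zero_right, Real.norm_of_nonneg ht.1]
    linarith [ht.2]
  have hd1 : ∀ t ∈ Set.Icc 0 (r / 2), HasDerivAt (fun t : ℝ => (ψ (t * ω)).re)
      (deriv ψ (t * ω) * ω).re t := fun t ht =>
    hasDerivAt_re_comp_ray (hball t (hmem t ht)).1.differentiableAt.hasDerivAt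
  have hd2 : ∀ t ∈ Set.Icc 0 (r / 2), HasDerivAt (fun t : ℝ => (deriv ψ (t * ω) * ω).re)
      (deriv (deriv ψ) (t * ω) * ω * ω).re t := fun t ht => by
    refine hasDerivAt_re_comp_ray (f := fun z => deriv ψ z * ω) ?_
    exact (hball t (hmem t ht)).1.deriv.differentiableAt.hasDerivAt.mul_const ω
  have hpos2 : ∀ t ∈ Set.Ioo 0 (r / 2), 0 < (deriv (deriv ψ) (t * ω) * ω * ω).re := by
    intro t ht
    obtain ⟨-, h2, h3⟩ := hball t (hmem t ⟨ht.1.le, ht.2.le⟩)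
    have : deriv (deriv ψ) (t * ω) * ω * ω =
        ((t ^ j : ℝ) : ℂ) * (ω ^ (j + 2) * g (t * ω)) := by
      rw [h2, sub_zero, smul_eq_mul]
      push_cast
      ring
    rw [this, Complex.re_ofReal_mul]
    exact mul_pos (pow_pos ht.1 j) h3
  have hmono : StrictMonoOn (fun t : ℝ => (deriv ψ (t * ω) * ω).re) (Set.Icc 0 (r / 2)) := by
    refine strictMonoOn_of_deriv_pos (convex_Icc _ _)
      (fun t ht => (hd2 t ht).continuousAt.continuousWithinAt) fun t ht => ?_
    rw [interior_Icc] at ht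
    rw [(hd2 t ⟨ht.1.le, ht.2.le⟩).deriv]
    exact hpos2 t ht
  have hcont : ContinuousOn (fun t : ℝ => (ψ (t * ω)).re) (Set.Icc 0 (r / 2)) :=
    fun t ht => (hd1 t ht).continuousAt.continuousWithinAt
  refine ⟨ω, hω0, r / 2, by positivity, ?_, ?_⟩
  · refine StrictMonoOn.strictConvexOn_of_deriv (convex_Icc _ _) hcont ?_
    rw [interior_Icc]
    intro s hs t ht hst
    rw [(hd1 s ⟨hs.1.le, hs.2.le⟩).deriv, (hd1 t ⟨ht.1.le, ht.2.le⟩).deriv]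
    exact hmono ⟨hs.1.le, hs.2.le⟩ ⟨ht.1.le, ht.2.le⟩ hst
  · have h0mem : (0 : ℝ) ∈ Set.Icc 0 (r / 2) := ⟨le_rfl, by positivity⟩
    -- The slope is nonnegative at 0 and strictly increasing, hence positive afterwards.
    have hmono0 : StrictMonoOn (fun t : ℝ => (ψ (t * ω)).re) (Set.Icc 0 (r / 2)) := by
      refine strictMonoOn_of_deriv_pos (convex_Icc _ _) hcont fun t ht => ?_
      rw [interior_Icc] at ht
      rw [(hd1 t ⟨ht.1.le, ht.2.le⟩).deriv]
      have h1 := hmono h0mem ⟨ht.1.le, ht.2.le⟩ ht.1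
      have h2 : ((deriv ψ ((0 : ℝ) * ω)) * ω).re = (ζ * (ω₀ * deriv ψ 0)).re := by
        rw [Complex.ofReal_zero, zero_mul, hω]
        ring_nf
      simp only at h1
      rw [h2] at h1
      exact hre0.trans_lt h1
    intro t ht
    have h1 := hmono0 h0mem ⟨ht.1.le, ht.2⟩ ht.1
    simp only [Complex.ofReal_zero, zero_mul] at h1
    rw [hψdef] at h1
    simp only [hlog0, Complex.zero_re, ← hre] at h1
    exact (Real.log_pos_iff (norm_nonneg _)).1 h1

/-- On some ray issuing from the origin, `‖Φ‖` is smaller than `1`. -/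
theorem exists_norm_lt_one_ray (hΦ : Differentiable ℂ Φ) (h0 : Φ 0 = 1)
    (hne : ¬ ∃ c, ∀ z, Φ z = c) :
    ∃ ω : ℂ, ω ≠ 0 ∧ ∃ δ : ℝ, 0 < δ ∧ ∀ t ∈ Set.Ioo 0 δ, ‖Φ ((t : ℝ) * ω)‖ < 1 := by
  have hψ := analyticAt_log_symbol hΦ h0
  have hnot : ¬ ∀ᶠ z in 𝓝 0, Complex.log (Φ z) = 0 := fun h =>
    hne ⟨1, fun z => by
      simpa using eq_exp_of_log_eventually_linear hΦ h0 (a := 0) (by simpa using h) z⟩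
  obtain ⟨k, g, hg, hg0, hgeq⟩ := hψ.exists_eventuallyEq_pow_smul_nonzero_iff.2 hnot
  have hk : 0 < k := by
    rw [Nat.pos_iff_ne_zero]
    rintro rfl
    have := hgeq.self_of_nhds
    simp only [h0, Complex.log_one, pow_zero, one_smul] at this
    exact hg0 this.symm
  -- Along this direction `log Φ(tω)` is asymptotic to `-t^k`.
  obtain ⟨ω, hω⟩ := IsAlgClosed.exists_pow_nat_eq (-(g 0)⁻¹) hk
  have hωk : ω ^ k * g 0 = -1 := by rw [hω, neg_mul, inv_mul_cancel₀ hg0]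
  have hω0 : ω ≠ 0 := by
    rintro rfl
    rw [zero_pow hk.ne'] at hωk
    simp at hωk
  have hneg : ∀ᶠ z in 𝓝 (0 : ℂ), (ω ^ k * g z).re < 0 := by
    have : ContinuousAt (fun z => (ω ^ k * g z).re) 0 :=
      Complex.continuous_re.continuousAt.comp (continuousAt_const.mul hg.continuousAt)
    refine this.eventually (gt_mem_nhds ?_)
    simp [hωk]
  obtain ⟨r, hr, hball⟩ := Metric.eventually_nhds_iff_ball.1
    ((tendsto_ray ω).eventually (hgeq.and hneg))
  refine ⟨ω, hω0, r, hr, fun t ht => ?_⟩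
  obtain ⟨h1, h2⟩ := hball t (by
    rw [Metric.mem_ball, dist_zero_right, Real.norm_of_nonneg ht.1.le]
    exact ht.2)
  have h3 : Complex.log (Φ (t * ω)) = ((t ^ k : ℝ) : ℂ) * (ω ^ k * g (t * ω)) := by
    rw [h1, sub_zero, smul_eq_mul]
    push_cast
    ring
  have h4 : Real.log ‖Φ (t * ω)‖ < 0 := by
    rw [← Complex.log_re, h3, Complex.re_ofReal_mul]
    exact mul_neg_of_pos_of_neg (pow_pos ht.1 k) h2
  by_contra! hcon
  exact absurd (Real.log_nonneg hcon) (not_le.2 h4)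

end Symbol

/-! ### Existence of hypercyclic algebras -/

/-- Jensen's inequality for a strictly convex function vanishing at the origin, with the missing
mass `1 - n / m` put at the origin. -/
theorem strictConvexOn_sum_div_lt {w : ℝ → ℝ} {δ : ℝ} (hw : StrictConvexOn ℝ (Set.Icc 0 δ) w)
    (hw0 : w 0 = 0) {m n : ℕ} (hm : 0 < m) (hn : n ≤ m) {x : Fin n → ℝ}
    (hx : ∀ i, x i ∈ Set.Icc 0 δ)
    (hne : (∃ i k, x i ≠ x k) ∨ (n < m ∧ ∃ i, x i ≠ 0)) :
    w ((∑ i, x i) / m) < (∑ i, w (x i)) / m := by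
  have hm' : (0 : ℝ) < m := by exact_mod_cast hm
  have hn' : (n : ℝ) ≤ m := by exact_mod_cast hn
  obtain ⟨i₀⟩ : Nonempty (Fin n) := by
    rcases hne with ⟨i, -⟩ | ⟨-, i, -⟩ <;> exact ⟨i⟩
  set wt : Option (Fin n) → ℝ := fun o => o.elim (1 - n / m) fun _ => 1 / m
  set pt : Option (Fin n) → ℝ := fun o => o.elim 0 x
  have h := (hw.map_sum_lt_iff_of_nonneg (t := Finset.univ) (w := wt) (p := pt) ?_ ?_ ?_).2 ?_
  · simp only [Fintype.sum_option, wt, pt, Option.elim, smul_eq_mul, mul_zero, hw0, zero_add,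
      ← Finset.mul_sum] at h
    rwa [one_div_mul_eq_div, one_div_mul_eq_div] at h
  · rintro (_ | i) -
    · simpa [wt] using div_le_one_of_le₀ hn' hm'.le
    · simp [wt]
  · simp only [Fintype.sum_option, wt, Option.elim, Finset.sum_const, Finset.card_univ,
      Fintype.card_fin, nsmul_eq_mul]
    ring
  · rintro (_ | i) -
    · exact ⟨le_rfl, (hx i₀).1.trans (hx i₀).2⟩
    · exact hx i
  · have hpos : ∀ i, wt (some i) ≠ 0 := fun i => (one_div_pos.2 hm').ne'
    rcases hne with ⟨i, k, hik⟩ | ⟨hlt, i, hi⟩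
    · exact ⟨some i, Finset.mem_univ _, some k, Finset.mem_univ _, hpos i, hpos k, hik⟩
    · refine ⟨some i, Finset.mem_univ _, none, Finset.mem_univ _, hpos i, ?_, hi⟩
      have : (n : ℝ) / m < 1 := (div_lt_one hm').2 (by exact_mod_cast hlt)
      change (1 : ℝ) - n / m ≠ 0
      linarith

/-! ### Strict Jensen inequality for the symbol and its stability. -/

section Ray

variable {Φ : ℂ → ℂ} {ω : ℂ} {δ : ℝ}

theorem norm_symbol_mul_exp_lt_one (h0 : Φ 0 = 1)
    (hconv : StrictConvexOn ℝ (Set.Icc 0 δ) (fun t : ℝ => Real.log ‖Φ (t * ω)‖))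
    (hone : ∀ t ∈ Set.Ioc 0 δ, 1 < ‖Φ ((t : ℝ) * ω)‖)
    {m n : ℕ} (hm : 0 < m) (hn : n ≤ m) {x : Fin n → ℝ} (hx : ∀ i, x i ∈ Set.Icc 0 δ)
    (hne : (∃ i k, x i ≠ x k) ∨ (n < m ∧ ∃ i, x i ≠ 0)) :
    ‖Φ (((∑ i, x i) / m : ℝ) * ω)‖ *
      Real.exp (-((∑ i, Real.log ‖Φ (x i * ω)‖) / m)) < 1 := by
  have hm' : (0 : ℝ) < m := by exact_mod_cast hm
  have hlt := strictConvexOn_sum_div_lt hconv (by simp [h0]) hm hn hx hne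
  obtain ⟨i₀⟩ : Nonempty (Fin n) := by
    rcases hne with ⟨i, -⟩ | ⟨-, i, -⟩ <;> exact ⟨i⟩
  have hδ : 0 ≤ δ := (hx i₀).1.trans (hx i₀).2
  have hmem : (∑ i, x i) / m ∈ Set.Icc 0 δ := by
    refine ⟨div_nonneg (Finset.sum_nonneg fun i _ => (hx i).1) hm'.le, ?_⟩
    rw [div_le_iff₀ hm']
    calc ∑ i, x i ≤ ∑ _i : Fin n, δ := Finset.sum_le_sum fun i _ => (hx i).2
      _ = δ * n := by simp [mul_comm]
      _ ≤ δ * m := by gcongr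
  have hpos : 0 < ‖Φ (((∑ i, x i) / m : ℝ) * ω)‖ := by
    rcases hmem.1.eq_or_lt with h | h
    · simp [← h, h0]
    · exact zero_lt_one.trans (hone _ ⟨h, hmem.2⟩)
  nth_rw 1 [← Real.exp_log hpos]
  rw [← Real.exp_add, Real.exp_lt_one_iff]
  linarith

/-- The strict inequality in `norm_symbol_mul_exp_lt_one` persists under small perturbations,
uniformly over the finitely many families with values in a given finite set. -/
theorem exists_perturbation_radius (hΦ : Continuous Φ) (h0 : Φ 0 = 1)
    (hconv : StrictConvexOn ℝ (Set.Icc 0 δ) (fun t : ℝ => Real.log ‖Φ (t * ω)‖))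
    (hone : ∀ t ∈ Set.Ioc 0 δ, 1 < ‖Φ ((t : ℝ) * ω)‖)
    {m : ℕ} (hm : 0 < m) (J : Finset ℝ) (hJ : ∀ x ∈ J, x ∈ Set.Icc 0 δ) :
    ∃ ρ : ℝ, 0 < ρ ∧ ∀ n ≤ m, ∀ x : Fin n → ℝ, (∀ i, x i ∈ J) → (∃ i k, x i ≠ x k) →
      ∀ y : ℂ, ‖y‖ < ρ → ‖Φ (((∑ i, x i) / m : ℝ) * ω + y)‖ *
        Real.exp (-((∑ i, Real.log ‖Φ (x i * ω)‖) / m)) < 1 := by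
  -- `Fin n → J` is a finite type, so only finitely many open conditions on `y` are imposed.
  have hev : ∀ᶠ y in 𝓝 (0 : ℂ), ∀ n ∈ Finset.range (m + 1), ∀ x : Fin n → J,
      (∃ i k, (x i : ℝ) ≠ x k) → ‖Φ (((∑ i, (x i : ℝ)) / m : ℝ) * ω + y)‖ *
        Real.exp (-((∑ i, Real.log ‖Φ ((x i : ℝ) * ω)‖) / m)) < 1 := by
    rw [Filter.eventually_all_finset]
    intro n hn
    rw [eventually_all]
    intro x
    by_cases hne : ∃ i k, (x i : ℝ) ≠ x k
    · have hcont : Continuous fun y : ℂ => ‖Φ (((∑ i, (x i : ℝ)) / m : ℝ) * ω + y)‖ *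
          Real.exp (-((∑ i, Real.log ‖Φ ((x i : ℝ) * ω)‖) / m)) := by fun_prop
      have hlt := norm_symbol_mul_exp_lt_one h0 hconv hone hm
        (Nat.lt_succ_iff.1 (Finset.mem_range.1 hn)) (fun i => hJ _ (x i).2) (Or.inl hne)
      filter_upwards [hcont.continuousAt.eventually (gt_mem_nhds (by simpa using hlt))]
        with y hy _ using hy
    · exact Eventually.of_forall fun y h => absurd h hne
  obtain ⟨ρ, hρ, hball⟩ := Metric.eventually_nhds_iff_ball.1 hev
  refine ⟨ρ, hρ, fun n hn x hx hne y hy => ?_⟩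
  exact hball y (by simpa using hy) n (Finset.mem_range.2 (Nat.lt_succ_of_le hn))
    (fun i => ⟨x i, hx i⟩) hne

end Ray

/-! ### Iterates of powers of exponential sums. -/

section Dynamics

variable {Φ : ℂ → ℂ} {T : entireFunctions →ₗ[ℂ] entireFunctions}

theorem iterate_expFun (hT : ∀ c, T (expFun c) = Φ c • expFun c) (N : ℕ) (c : ℂ) :
    (T ^ N) (expFun c) = Φ c ^ N • expFun c := by
  induction N with
  | zero => simp
  | succ N ih => rw [pow_succ', Module.End.mul_apply, ih, map_smul, hT, smul_smul, pow_succ]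

theorem iterate_pow_combination (hT : ∀ c, T (expFun c) = Φ c • expFun c) {S : Type*} [Fintype S]
    (d κ ν : S → ℂ) (n N : ℕ) :
    T^[N] ((∑ s, (d s * κ s ^ N) • expFun (ν s)) ^ n) =
      ∑ p : Fin n → S, ((∏ i, d (p i)) * (Φ (∑ i, ν (p i)) * ∏ i, κ (p i)) ^ N) •
        expFun (∑ i, ν (p i)) := by
  rw [← Module.End.pow_apply, Fintype.sum_pow, map_sum]
  refine Finset.sum_congr rfl fun p _ => ?_
  rw [Finset.prod_smul, prod_expFun, map_smul, iterate_expFun hT, smul_smul,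
    Finset.prod_mul_distrib, Finset.prod_pow, mul_pow]
  congr 1
  ring

theorem tendsto_coeff_smul {D q : ℂ} (f : entireFunctions) (hq : ‖q‖ < 1) :
    Tendsto (fun N : ℕ => (D * q ^ N) • f) atTop (𝓝 0) := by
  have h := ((tendsto_pow_atTop_nhds_zero_of_norm_lt_one hq).const_mul D).smul_const f
  simpa using h

theorem tendsto_iterate_pow_zero (hT : ∀ c, T (expFun c) = Φ c • expFun c) {S : Type*}
    [Fintype S] {d κ ν : S → ℂ} {n : ℕ}
    (h : ∀ p : Fin n → S, ‖Φ (∑ i, ν (p i)) * ∏ i, κ (p i)‖ < 1) :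
    Tendsto (fun N : ℕ => T^[N] ((∑ s, (d s * κ s ^ N) • expFun (ν s)) ^ n)) atTop (𝓝 0) := by
  simp only [iterate_pow_combination hT]
  simpa using tendsto_finsetSum (Finset.univ : Finset (Fin n → S))
    fun p _ => tendsto_coeff_smul (D := ∏ i, d (p i)) (expFun (∑ i, ν (p i))) (h p)

theorem tendsto_iterate_pow (hT : ∀ c, T (expFun c) = Φ c • expFun c) {S J : Type*}
    [Fintype S] [Fintype J] (e : J → S) (he : Function.Injective e) {d κ ν : S → ℂ} {m : ℕ}
    (hm : 0 < m)
    (h : ∀ p : Fin m → S, (∀ j, p ≠ fun _ => e j) → ‖Φ (∑ i, ν (p i)) * ∏ i, κ (p i)‖ < 1)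
    (hJ : ∀ j, Φ (m * ν (e j)) * κ (e j) ^ m = 1) :
    Tendsto (fun N : ℕ => T^[N] ((∑ s, (d s * κ s ^ N) • expFun (ν s)) ^ m)) atTop
      (𝓝 (∑ j, d (e j) ^ m • expFun (m * ν (e j)))) := by
  classical
  simp only [iterate_pow_combination hT]
  have hsum : ∑ j, d (e j) ^ m • expFun (m * ν (e j)) = ∑ p : Fin m → S,
      ∑ j, if p = fun _ => e j then d (e j) ^ m • expFun (m * ν (e j)) else 0 := by
    rw [Finset.sum_comm]
    simp
  rw [hsum]
  refine tendsto_finsetSum _ fun p _ => ?_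
  by_cases hp : ∃ j, p = fun _ => e j
  · obtain ⟨j, rfl⟩ := hp
    have hinj : ∀ j', ((fun _ : Fin m => e j) = fun _ => e j') ↔ j = j' := fun j' =>
      ⟨fun hjj => he (congrFun hjj ⟨0, hm⟩), fun hjj => by rw [hjj]⟩
    simp only [hinj, Finset.sum_ite_eq, Finset.mem_univ, if_true, Finset.prod_const,
      Finset.sum_const, Finset.card_univ, Fintype.card_fin, nsmul_eq_mul, hJ, one_pow, mul_one]
    exact tendsto_const_nhds
  · push Not at hp
    rw [Finset.sum_eq_zero fun j _ => if_neg (hp j)]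
    exact tendsto_coeff_smul _ (h p hp)

/-- A linear operator acting on exponentials as multiplication by a symbol `Φ` with `Φ 0 = 1` has
a hypercyclic algebra as soon as `log ‖Φ‖` is strictly convex and positive on some ray and
negative on another one, both near the origin. -/
theorem hasHypercyclicAlgebra_of_rays (hTc : Continuous T)
    (hT : ∀ c, T (expFun c) = Φ c • expFun c) (hΦ : Continuous Φ) (h0 : Φ 0 = 1)
    {ω ω' : ℂ} (hω : ω ≠ 0) (hω' : ω' ≠ 0) {δ δ' : ℝ} (hδ : 0 < δ) (hδ' : 0 < δ')
    (hconv : StrictConvexOn ℝ (Set.Icc 0 δ) (fun t : ℝ => Real.log ‖Φ (t * ω)‖))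
    (hone : ∀ t ∈ Set.Ioc 0 δ, 1 < ‖Φ ((t : ℝ) * ω)‖)
    (hlt : ∀ t ∈ Set.Ioo 0 δ', ‖Φ ((t : ℝ) * ω')‖ < 1) :
    HasHypercyclicAlgebra (T : entireFunctions → entireFunctions) := by
  classical
  refine hasHypercyclicAlgebra_of_transitive T ⟨T.map_add, T.map_smul⟩ hTc ?_
  intro m hm U V W hU hUne hV hVne hW h0W
  have hm' : (0 : ℝ) < m := by exact_mod_cast hm
  have hmc : (m : ℂ) ≠ 0 := by exact_mod_cast hm.ne'
  obtain ⟨J, c, hJ, hcV⟩ := expFun_combination_dense hω hδ hV hVne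
  -- The value 0 stands for the terms approximating `U`, which have no component along `ω`.
  obtain ⟨ρ, hρ, hpert⟩ := exists_perturbation_radius hΦ h0 hconv hone hm (insert 0 J) (by
    intro x hx
    rcases Finset.mem_insert.1 hx with rfl | hx
    · exact ⟨le_rfl, hδ.le⟩
    · exact ⟨(hJ x hx).1.le, (hJ x hx).2.le⟩)
  -- A sum of at most `m` parameters below `η` stays below `δ'`, and as a multiple of `ω'` it has
  -- norm below `ρ`.
  set η : ℝ := min (δ' / m) (ρ / (m * ‖ω'‖)) with hη
  have hω'n : 0 < ‖ω'‖ := norm_pos_iff.2 hω'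
  have hηpos : 0 < η := lt_min (by positivity) (by positivity)
  obtain ⟨L, a, hL, haU⟩ := expFun_combination_dense hω' hηpos hU hUne
  choose b hb using fun x => IsAlgClosed.exists_pow_nat_eq (c x) hm
  choose k hk using fun x : ℝ => IsAlgClosed.exists_pow_nat_eq (Φ (x * ω))⁻¹ hm
  set w : ℝ → ℝ := fun t => Real.log ‖Φ (t * ω)‖ with hw
  have hw0 : w 0 = 0 := by simp [hw, h0]
  have hknorm : ∀ x ∈ J, ‖k x‖ = Real.exp (-(w x / m)) := by
    intro x hx
    have h1 := hone x ⟨(hJ x hx).1, (hJ x hx).2.le⟩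
    refine (pow_left_inj₀ (norm_nonneg _) (Real.exp_nonneg _) hm.ne').1 ?_
    rw [← norm_pow, hk, norm_inv, ← Real.exp_nat_mul, mul_neg, mul_div_cancel₀ _ hm'.ne',
      Real.exp_neg, Real.exp_log (by linarith)]
  let d : L ⊕ J → ℂ := Sum.elim (fun s => a s) fun x => b x
  let κ : L ⊕ J → ℂ := Sum.elim (fun _ => 1) fun x => k x
  let sOf : L ⊕ J → ℝ := Sum.elim (fun s => s) fun _ => 0
  let xOf : L ⊕ J → ℝ := Sum.elim (fun _ => 0) fun x => x
  let ν : L ⊕ J → ℂ := fun i => (xOf i / m : ℝ) * ω + sOf i * ω'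
  have hxJ : ∀ i, xOf i ∈ insert 0 J := by
    rintro (s | x)
    · exact Finset.mem_insert_self _ _
    · exact Finset.mem_insert_of_mem x.2
  have hxδ : ∀ i, xOf i ∈ Set.Icc 0 δ := by
    rintro (s | x)
    · exact ⟨le_rfl, hδ.le⟩
    · exact ⟨(hJ x x.2).1.le, (hJ x x.2).2.le⟩
  have hsη : ∀ i, 0 ≤ sOf i ∧ sOf i < η := by
    rintro (s | x)
    · exact ⟨(hL s s.2).1.le, (hL s s.2).2⟩
    · exact ⟨le_rfl, hηpos⟩
  have hκ : ∀ i, ‖κ i‖ = Real.exp (-(w (xOf i) / m)) := by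
    rintro (s | x)
    · simp [κ, xOf, hw0]
    · exact hknorm x x.2
  have hsum : ∀ {n : ℕ} (p : Fin n → L ⊕ J), ∑ i, ν (p i) =
      ((∑ i, xOf (p i)) / m : ℝ) * ω + (∑ i, sOf (p i) : ℝ) * ω' := by
    intro n p
    simp only [ν, Finset.sum_add_distrib, ← Finset.sum_mul, ← Complex.ofReal_sum,
      ← Finset.sum_div]
  have hprod : ∀ {n : ℕ} (p : Fin n → L ⊕ J), ∏ i, ‖κ (p i)‖ =
      Real.exp (-((∑ i, w (xOf (p i))) / m)) := by
    intro n p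
    simp only [hκ, ← Real.exp_sum, Finset.sum_neg_distrib, Finset.sum_div]
  -- Mixed products are perturbations of a nonconstant Jensen family, products over `L` alone fall
  -- on the ray of `ω'`, and products over `J` alone are strict Jensen unless constant with `n = m`.
  have hsmall : ∀ n : ℕ, 0 < n → n ≤ m → ∀ p : Fin n → L ⊕ J,
      (n = m → ∀ j : J, p ≠ fun _ => Sum.inr j) → ‖Φ (∑ i, ν (p i)) * ∏ i, κ (p i)‖ < 1 := by
    intro n hn hnm p hp
    have hSlt : ∑ i, sOf (p i) < m * η := by
      have : (Finset.univ : Finset (Fin n)).Nonempty := ⟨⟨0, hn⟩, Finset.mem_univ _⟩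
      calc ∑ i, sOf (p i) < ∑ _i : Fin n, η :=
            Finset.sum_lt_sum_of_nonempty this fun i _ => (hsη (p i)).2
        _ = n * η := by simp
        _ ≤ m * η := by gcongr
    have hSnn : 0 ≤ ∑ i, sOf (p i) := Finset.sum_nonneg fun i _ => (hsη (p i)).1
    rw [norm_mul, norm_prod, hprod, hsum]
    by_cases hinl : ∃ i s, p i = Sum.inl s
    · obtain ⟨i₀, s₀, hi₀⟩ := hinl
      by_cases hinr : ∃ i x, p i = Sum.inr x
      · obtain ⟨i₁, x₁, hi₁⟩ := hinr
        refine hpert n hnm _ (fun i => hxJ (p i)) ⟨i₁, i₀, ?_⟩ _ ?_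
        · simp only [hi₀, hi₁, xOf, Sum.elim_inl, Sum.elim_inr]
          exact (hJ x₁ x₁.2).1.ne'
        · rw [norm_mul, Complex.norm_real, Real.norm_of_nonneg hSnn]
          calc (∑ i, sOf (p i)) * ‖ω'‖ < m * η * ‖ω'‖ := by gcongr
            _ ≤ m * (ρ / (m * ‖ω'‖)) * ‖ω'‖ := by
              gcongr
              exact min_le_right _ _
            _ = ρ := by field_simp
      · have hx0 : ∀ i, xOf (p i) = 0 := by
          intro i
          rcases hpi : p i with s | x
          · rfl
          · exact absurd ⟨i, x, hpi⟩ hinr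
        simp only [hx0, hw0, Finset.sum_const_zero, zero_div, neg_zero, Real.exp_zero, mul_one,
          Complex.ofReal_zero, zero_mul, zero_add]
        refine hlt _ ⟨?_, ?_⟩
        · refine Finset.sum_pos' (fun i _ => (hsη (p i)).1) ⟨i₀, Finset.mem_univ _, ?_⟩
          rw [hi₀]
          exact (hL s₀ s₀.2).1
        · calc ∑ i, sOf (p i) < m * η := hSlt
            _ ≤ m * (δ' / m) := by
              gcongr
              exact min_le_left _ _
            _ = δ' := by field_simp
    · have hinr : ∀ i, ∃ x : J, p i = Sum.inr x := by
        intro i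
        rcases hpi : p i with s | x
        · exact absurd ⟨i, s, hpi⟩ hinl
        · exact ⟨x, rfl⟩
      have hs0 : ∀ i, sOf (p i) = 0 := by
        intro i
        obtain ⟨x, hx⟩ := hinr i
        rw [hx]
        rfl
      simp only [hs0, Finset.sum_const_zero, Complex.ofReal_zero, zero_mul, add_zero]
      refine norm_symbol_mul_exp_lt_one h0 hconv hone hm hnm (fun i => hxδ (p i)) ?_
      obtain ⟨x₀, hx₀⟩ := hinr ⟨0, hn⟩
      rcases hnm.lt_or_eq with hlt' | heq
      · refine Or.inr ⟨hlt', ⟨0, hn⟩, ?_⟩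
        rw [hx₀]
        exact (hJ x₀ x₀.2).1.ne'
      · left
        by_contra! hcon
        refine hp heq x₀ (funext fun i => ?_)
        obtain ⟨x, hx⟩ := hinr i
        have := hcon i ⟨0, hn⟩
        rw [hx, hx₀] at this
        rw [hx, Subtype.ext this]
  set u : ℕ → entireFunctions := fun N => ∑ i, (d i * κ i ^ N) • expFun (ν i) with hu
  have hνr : ∀ x : J, (m : ℂ) * ν (Sum.inr x) = (x : ℝ) * ω := by
    intro x
    simp only [ν, xOf, sOf, Sum.elim_inr, Complex.ofReal_zero, zero_mul, add_zero]
    push_cast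
    field_simp
  have hlimV : Tendsto (fun N : ℕ => T^[N] (u N ^ m)) atTop
      (𝓝 (∑ x ∈ J, c x • expFun (x * ω))) := by
    have h := tendsto_iterate_pow hT (Sum.inr : J → L ⊕ J) Sum.inr_injective (d := d) (κ := κ)
      (ν := ν) hm (fun p hp => hsmall m hm le_rfl p fun _ => hp) (fun x => by
        rw [hνr]
        change Φ _ * k x ^ m = 1
        rw [hk]
        have := hone x ⟨(hJ x x.2).1, (hJ x x.2).2.le⟩
        refine mul_inv_cancel₀ fun h => ?_
        rw [h, norm_zero] at this
        linarith)
    convert! h using 2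
    rw [← Finset.sum_coe_sort]
    refine Finset.sum_congr rfl fun x _ => ?_
    rw [hνr]
    change _ = b x ^ m • _
    rw [hb]
  have hlimU : Tendsto u atTop (𝓝 (∑ s ∈ L, a s • expFun (s * ω'))) := by
    have hsplit : ∀ N, u N = ∑ s ∈ L, a s • expFun (s * ω') +
        ∑ x : J, (b x * k x ^ N) • expFun (ν (Sum.inr x)) := by
      intro N
      simp only [hu, Fintype.sum_sum_type]
      congr 1
      rw [← Finset.sum_coe_sort L]
      refine Finset.sum_congr rfl fun s _ => ?_
      simp [d, κ, ν, xOf, sOf]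
    have hz : Tendsto (fun N : ℕ => ∑ x : J, (b x * k x ^ N) • expFun (ν (Sum.inr x))) atTop
        (𝓝 0) := by
      have hzero : (0 : entireFunctions) = ∑ _x : J, (0 : entireFunctions) := by simp
      rw [hzero]
      refine tendsto_finsetSum _ fun x _ => tendsto_coeff_smul _ ?_
      rw [hknorm x x.2, Real.exp_lt_one_iff, neg_lt_zero]
      exact div_pos (Real.log_pos (hone x ⟨(hJ x x.2).1, (hJ x x.2).2.le⟩)) hm'
    have h := hz.const_add (∑ s ∈ L, a s • expFun (s * ω'))
    rw [add_zero] at h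
    exact h.congr fun N => (hsplit N).symm
  have hlimW : ∀ i ∈ Finset.Ico 1 m, Tendsto (fun N : ℕ => T^[N] (u N ^ i)) atTop (𝓝 0) := by
    intro i hi
    rw [Finset.mem_Ico] at hi
    exact tendsto_iterate_pow_zero hT fun p =>
      hsmall i hi.1 hi.2.le p fun h => absurd h hi.2.ne
  have hevW : ∀ᶠ N in atTop, ∀ i ∈ Finset.Ico 1 m, T^[N] (u N ^ i) ∈ W := by
    rw [Filter.eventually_all_finset]
    exact fun i hi => (hlimW i hi).eventually (hW.mem_nhds h0W)
  obtain ⟨N, h1, h2, h3⟩ := ((hlimU.eventually (hU.mem_nhds haU)).and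
    ((hlimV.eventually (hV.mem_nhds hcV)).and hevW)).exists
  exact ⟨u N, h1, N, h2, h3⟩

end Dynamics

theorem HasGeometricDerivBound.hasHypercyclicAlgebra {Φ : ℂ → ℂ} {C τ : ℝ}
    (h : HasGeometricDerivBound Φ C τ) (hΦ : Differentiable ℂ Φ) (h0 : Φ 0 = 1)
    (hne : ¬ ∃ a : ℂ, ∀ z, Φ z = Complex.exp (a * z)) :
    HasHypercyclicAlgebra (convolutionOp Φ) := by
  obtain ⟨ω, hω, δ, hδ, hconv, hone⟩ := exists_strictConvexOn_ray hΦ h0 hne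
  obtain ⟨ω', hω', δ', hδ', hlt⟩ := exists_norm_lt_one_ray hΦ h0 (by
    rintro ⟨c, hc⟩
    exact hne ⟨0, fun z => by rw [hc z, ← hc 0, h0]; simp⟩)
  exact hasHypercyclicAlgebra_of_rays (T := h.linearMap) h.continuous_linearMap
    (h.convolutionOp_expFun hΦ) hΦ.continuous h0 hω hω' hδ hδ' hconv hone hlt

/-! ### Growth -/

theorem norm_le_maxModulus {f : ℂ → ℂ} (hf : Continuous f) {z : ℂ} {r : ℝ} (hz : ‖z‖ ≤ r) :
    ‖f z‖ ≤ maxModulus f r := by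
  refine le_csSup ?_ ⟨z, by simpa using hz, rfl⟩
  exact ((isCompact_closedBall (0 : ℂ) r).image hf.norm).bddAbove

theorem HasGrowth.eventually_maxModulus_le {f : ℂ → ℂ} {τ σ : ℝ} (h : HasGrowth f 1 τ)
    (hconst : ¬ ∃ c, ∀ z, f z = c) (hτ : τ < σ) (hσ : 0 < σ) :
    ∀ᶠ r in atTop, maxModulus f r ≤ Real.exp (σ * r) := by
  suffices hlog : ∀ᶠ r in atTop, Real.log (maxModulus f r) ≤ σ * r by
    filter_upwards [hlog] with r hr
    exact (Real.le_exp_log _).trans (Real.exp_le_exp.2 hr)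
  rcases h with h | ⟨h1, h2⟩
  · rw [growthOrder, if_neg hconst] at h
    obtain ⟨q, hq, hq1⟩ := EReal.lt_iff_exists_real_btwn.1 h
    have hq1' : q < 1 := by exact_mod_cast hq1
    have hpow : ∀ᶠ r : ℝ in atTop, r ^ (-(1 - q)) < σ :=
      (tendsto_rpow_neg_atTop (by linarith : 0 < 1 - q)).eventually (gt_mem_nhds hσ)
    filter_upwards [eventually_lt_of_limsup_lt hq, hpow, eventually_gt_atTop 1] with r hr hr2 hr1
    have hlr : 0 < Real.log r := Real.log_pos hr1
    have hr0 : 0 < r := by linarith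
    -- The iterated logarithm carries information only when the inner one is positive.
    rcases le_or_gt (Real.log (maxModulus f r)) 0 with hneg | hpos
    · exact hneg.trans (by positivity)
    · have hr' : Real.log (Real.log (maxModulus f r)) / Real.log r < q := by exact_mod_cast hr
      rw [div_lt_iff₀ hlr] at hr'
      calc Real.log (maxModulus f r) = Real.exp (Real.log (Real.log (maxModulus f r))) :=
            (Real.exp_log hpos).symm
        _ ≤ Real.exp (q * Real.log r) := Real.exp_le_exp.2 hr'.le
        _ = r ^ q := by rw [Real.rpow_def_of_pos hr0, mul_comm]
        _ = r ^ (-(1 - q)) * r := by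
            rw [← Real.rpow_add_one hr0.ne']
            ring_nf
        _ ≤ σ * r := by gcongr
  · have h2' : growthType f < (σ : EReal) := h2.trans_lt (by exact_mod_cast hτ)
    rw [growthType, h1] at h2'
    filter_upwards [eventually_lt_of_limsup_lt h2', eventually_gt_atTop 0] with r hr hr0
    rw [EReal.coe_lt_coe_iff, EReal.toReal_coe, Real.rpow_neg_one, inv_mul_lt_iff₀ hr0] at hr
    linarith

theorem IsExponentialType.exists_norm_le {f : ℂ → ℂ} (h : IsExponentialType f)
    (hf : Continuous f) (hconst : ¬ ∃ c, ∀ z, f z = c) :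
    ∃ C σ : ℝ, 1 ≤ C ∧ 0 < σ ∧ ∀ z, ‖f z‖ ≤ C * Real.exp (σ * ‖z‖) := by
  obtain ⟨τ, hτ⟩ := h
  have hσ : 0 < max τ 0 + 1 := by positivity
  obtain ⟨R, hR⟩ := eventually_atTop.1
    (hτ.eventually_maxModulus_le hconst (by linarith [le_max_left τ 0] : τ < max τ 0 + 1) hσ)
  obtain ⟨C, hC⟩ := (isCompact_closedBall (0 : ℂ) R).exists_bound_of_continuousOn hf.continuousOn
  refine ⟨max C 1, max τ 0 + 1, le_max_right _ _, hσ, fun z => ?_⟩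
  have h1 : 1 ≤ Real.exp ((max τ 0 + 1) * ‖z‖) := Real.one_le_exp (by positivity)
  rcases le_total R ‖z‖ with hz | hz
  · calc ‖f z‖ ≤ maxModulus f ‖z‖ := norm_le_maxModulus hf le_rfl
      _ ≤ Real.exp ((max τ 0 + 1) * ‖z‖) := hR _ hz
      _ ≤ _ := le_mul_of_one_le_left (Real.exp_nonneg _) (le_max_right _ _)
  · calc ‖f z‖ ≤ C := hC z (by simpa using hz)
      _ ≤ max C 1 := le_max_left _ _
      _ ≤ _ := le_mul_of_one_le_right (by positivity) h1

/-- Cauchy's estimate at the radius `n / σ`, which minimises `e^{σr} / r^n`, combined with `n! ≤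
n^n`. -/
theorem hasGeometricDerivBound_of_norm_le {f : ℂ → ℂ} (hf : Differentiable ℂ f) {C σ : ℝ}
    (hC : 0 ≤ C) (hσ : 0 < σ) (h : ∀ z, ‖f z‖ ≤ C * Real.exp (σ * ‖z‖)) :
    HasGeometricDerivBound f C (Real.exp 1 * σ) := by
  refine ⟨hC, by positivity, fun n => ?_⟩
  rcases Nat.eq_zero_or_pos n with rfl | hn
  · simpa using h 0
  · have hn' : (0 : ℝ) < n := by exact_mod_cast hn
    have h1 := Complex.norm_iteratedDeriv_le_of_forall_mem_sphere_norm_le n (c := 0)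
      (R := n / σ) (C := C * Real.exp n) (by positivity) hf.diffContOnCl fun z hz => by
        have hz' : ‖z‖ = n / σ := by simpa using hz
        have := h z
        rwa [hz', mul_div_cancel₀ _ hσ.ne'] at this
    have hfac : (n.factorial : ℝ) ≤ (n : ℝ) ^ n := by exact_mod_cast Nat.factorial_le_pow n
    calc ‖iteratedDeriv n f 0‖ ≤ n.factorial * (C * Real.exp n) / (n / σ) ^ n := h1
      _ ≤ (n : ℝ) ^ n * (C * Real.exp n) / (n / σ) ^ n := by gcongr
      _ = C * (Real.exp 1 * σ) ^ n := by
          rw [div_pow, mul_pow, ← Real.exp_nat_mul, mul_one]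
          field_simp

theorem IsSubexponential.not_exp {Φ : ℂ → ℂ} (h : IsSubexponential Φ)
    (hconst : ¬ ∃ c, ∀ z, Φ z = c) : ¬ ∃ a : ℂ, ∀ z, Φ z = Complex.exp (a * z) := by
  rintro ⟨a, ha⟩
  have ha0 : a ≠ 0 := by
    rintro rfl
    exact hconst ⟨1, fun z => by simp [ha z]⟩
  have hna : 0 < ‖a‖ := norm_pos_iff.2 ha0
  have hcont : Continuous Φ := by
    rw [funext ha]
    fun_prop
  obtain ⟨r, hr, hr0⟩ := ((HasGrowth.eventually_maxModulus_le h hconst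
    (by positivity : (0 : ℝ) < ‖a‖ / 2) (by positivity)).and (eventually_gt_atTop 0)).exists
  -- At this point `a * z = r * ‖a‖`, so `‖Φ‖` is `e^{r‖a‖}`, exceeding the bound `e^{r‖a‖/2}`.
  have hz : ‖(r / a * ‖a‖ : ℂ)‖ ≤ r := by
    rw [norm_mul, norm_div, Complex.norm_real, Complex.norm_real, norm_norm,
      div_mul_cancel₀ _ hna.ne', Real.norm_of_nonneg hr0.le]
  have h1 := (norm_le_maxModulus hcont hz).trans hr
  have h2 : a * (r / a * ‖a‖) = ((r * ‖a‖ : ℝ) : ℂ) := by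
    push_cast
    field_simp
  rw [ha, h2, Complex.norm_exp, Complex.ofReal_re, Real.exp_le_exp] at h1
  nlinarith

/-- An entire function of exponential type without zeros is an exponential. -/
theorem eq_exp_of_forall_ne_zero {Φ : ℂ → ℂ} (hΦ : Differentiable ℂ Φ) (h0 : Φ 0 = 1) {C σ : ℝ}
    (hC : 1 ≤ C) (hσ : 0 < σ) (hle : ∀ z, ‖Φ z‖ ≤ C * Real.exp (σ * ‖z‖))
    (hne : ∀ z, Φ z ≠ 0) : ∃ a : ℂ, ∀ z, Φ z = Complex.exp (a * z) := by
  have hq : Differentiable ℂ fun z => deriv Φ z / Φ z :=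
    hΦ.contDiff.differentiable_deriv_two.div hΦ hne
  obtain ⟨G, hG⟩ := hq.isExactOn_univ
  set g : ℂ → ℂ := fun z => G z - G 0 with hg
  have hgd : ∀ z, HasDerivAt g (deriv Φ z / Φ z) z := fun z =>
    (hG z (Set.mem_univ z)).sub_const _
  have hgdiff : Differentiable ℂ g := fun z => (hgd z).differentiableAt
  have hg0 : g 0 = 0 := sub_self _
  have hexp : ∀ z, Φ z = Complex.exp (g z) := by
    have hd : ∀ z, HasDerivAt (fun z => Φ z * Complex.exp (-g z)) 0 z := fun z => by
      have := (hΦ z).hasDerivAt.mul ((hgd z).neg.cexp)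
      convert! this using 1
      field_simp [hne z]
      ring
    intro z
    have hc := is_const_of_deriv_eq_zero (fun z => (hd z).differentiableAt)
      (fun z => (hd z).deriv) z 0
    simp only [h0, hg0, neg_zero, Complex.exp_zero, mul_one, Complex.exp_neg] at hc
    exact (mul_inv_eq_one₀ (Complex.exp_ne_zero _)).1 hc
  have hre : ∀ z, (g z).re ≤ Real.log C + σ * ‖z‖ := fun z => by
    have h1 := hle z
    rw [hexp, Complex.norm_exp, ← Real.exp_log (by linarith : 0 < C), ← Real.exp_add,
      Real.exp_le_exp] at h1
    exact h1
  have hlogC : 0 ≤ Real.log C := Real.log_nonneg hC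
  -- Borel–Carathéodory on the disc of radius `2 * r` upgrades the linear bound on the real part to
  -- one on `‖g‖`; Cauchy's estimates then leave only the linear Taylor term.
  have hbound : ∀ r : ℝ, 0 < r → ∀ z : ℂ, ‖z‖ = r →
      ‖g z‖ ≤ 2 * (Real.log C + σ * (2 * r)) := by
    intro r hr z hz
    have h1 := Complex.borelCaratheodory (R := 2 * r) (M := Real.log C + σ * (2 * r)) (f := g)
      (z := z) (by positivity) hgdiff.differentiableOn (fun w hw => by
        have hw' : ‖w‖ < 2 * r := by simpa using hw
        refine (hre w).trans ?_
        gcongr) (by positivity) (by simp [hz]; linarith)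
    rw [hg0, norm_zero, zero_mul, zero_div, add_zero, hz] at h1
    convert! h1 using 1
    field_simp
    ring
  have hder : ∀ n : ℕ, 2 ≤ n → iteratedDeriv n g 0 = 0 := by
    intro n hn
    have hlim : Tendsto (fun r : ℝ => n.factorial * (2 * (Real.log C * (r ^ n)⁻¹ +
        2 * σ * (r ^ (n - 1))⁻¹))) atTop (𝓝 0) := by
      have h1 : Tendsto (fun r : ℝ => (r ^ n)⁻¹) atTop (𝓝 0) :=
        tendsto_inv_atTop_zero.comp (tendsto_pow_atTop (by omega))
      have h2 : Tendsto (fun r : ℝ => (r ^ (n - 1))⁻¹) atTop (𝓝 0) :=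
        tendsto_inv_atTop_zero.comp (tendsto_pow_atTop (by omega))
      simpa using (((h1.const_mul (Real.log C)).add (h2.const_mul (2 * σ))).const_mul 2).const_mul
        (n.factorial : ℝ)
    refine norm_le_zero_iff.1 (ge_of_tendsto hlim ?_)
    filter_upwards [eventually_gt_atTop 0] with r hr
    refine (Complex.norm_iteratedDeriv_le_of_forall_mem_sphere_norm_le n hr hgdiff.diffContOnCl
      fun z hz => hbound r hr z (by simpa using hz)).trans_eq ?_
    obtain ⟨k, rfl⟩ : ∃ k, n = k + 1 := ⟨n - 1, by omega⟩
    rw [Nat.add_sub_cancel, pow_succ]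
    field_simp
  refine ⟨iteratedDeriv 1 g 0, fun z => ?_⟩
  rw [hexp]
  congr 1
  refine (Complex.hasSum_taylorSeries_of_entire hgdiff 0 z).unique ?_
  have h1 := hasSum_single (f := fun n : ℕ => ((n.factorial : ℂ)⁻¹ •
    (z - 0) ^ n • iteratedDeriv n g 0)) 1 fun n hn => by
      rcases Nat.lt_or_ge n 2 with h | h
      · obtain rfl : n = 0 := by omega
        simp [hg0]
      · simp [hder n h]
  convert! h1 using 1
  simp [mul_comm]

/-! ### Translations have no hypercyclic algebra -/

/-- The series `∑ a^n f^(n)(z) / n!` is the Taylor expansion of `f` about `z`, evaluated at `z + a`.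
-/
theorem HasGeometricDerivBound.convolutionOp_exp_apply {Φ : ℂ → ℂ} {C τ : ℝ} {a : ℂ}
    (h : HasGeometricDerivBound Φ C τ) (ha : ∀ z, Φ z = Complex.exp (a * z))
    (f : entireFunctions) (z : ℂ) : (convolutionOp Φ f).1 z = f.1 (z + a) := by
  refine (h.hasSum_convolutionOp_apply f z).unique ?_
  have hf : Differentiable ℂ f.1 := f.2
  refine (Complex.hasSum_taylorSeries_of_entire hf z (z + a)).congr_fun fun n => ?_
  rw [funext ha, iteratedDeriv_cexp_const_mul]
  simp only [mul_zero, Complex.exp_zero, mul_one, add_sub_cancel_left, smul_eq_mul]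
  ring

/-- The identity function on the unit circle is not close to the square of a continuous
function. -/
theorem not_forall_norm_sq_sub_lt_one {h : ℂ → ℂ} (hc : Continuous h) :
    ¬ ∀ z : ℂ, ‖z‖ ≤ 1 → ‖h z ^ 2 - z‖ < 1 := by
  intro hlt
  set e : ℝ → ℂ := fun θ => Complex.exp (θ * Complex.I) with he
  have hec : Continuous e := by fun_prop
  have hen : ∀ θ, ‖e θ‖ = 1 := fun θ => Complex.norm_exp_ofReal_mul_I θ
  have he0 : ∀ θ, e θ ≠ 0 := fun θ => Complex.exp_ne_zero _
  set q : ℝ → ℂ := fun θ => h (e θ) ^ 2 / e θ with hq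
  have hqs : ∀ θ, q θ ∈ Complex.slitPlane := fun θ => by
    suffices hlt1 : ‖q θ - 1‖ < 1 by simpa using Complex.mem_slitPlane_of_norm_lt_one hlt1
    have : q θ - 1 = (h (e θ) ^ 2 - e θ) / e θ := by
      simp only [hq]
      field_simp [he0 θ]
    rw [this, norm_div, hen, div_one]
    exact hlt _ (hen θ).le
  have hqc : Continuous q := ((hc.comp hec).pow 2).div hec he0
  -- A continuous square root of `h(e θ)^2`: the first factor is `2π`-periodic and the half-angle
  -- factor changes sign. By connectedness `h ∘ e = ±s`, contradicting the periodicity of `h ∘ e`.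
  set s : ℝ → ℂ := fun θ => Complex.exp (Complex.log (q θ) / 2) * Complex.exp (θ / 2 * Complex.I)
    with hs
  have hsc : Continuous s := by
    refine Continuous.mul ((hqc.clog hqs).div_const 2).cexp ?_
    fun_prop
  have hs0 : ∀ θ, s θ ≠ 0 := fun θ => mul_ne_zero (Complex.exp_ne_zero _) (Complex.exp_ne_zero _)
  have hsq : ∀ θ, h (e θ) ^ 2 = s θ ^ 2 := fun θ => by
    have h1 : Complex.exp (Complex.log (q θ) / 2) ^ 2 = q θ := by
      rw [← Complex.exp_nat_mul, Nat.cast_ofNat, mul_div_cancel₀ _ two_ne_zero,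
        Complex.exp_log (Complex.slitPlane_ne_zero (hqs θ))]
    have h2 : Complex.exp (θ / 2 * Complex.I) ^ 2 = e θ := by
      rw [← Complex.exp_nat_mul]
      congr 1
      push_cast
      ring
    rw [hs, mul_pow, h1, h2, hq]
    field_simp [he0 θ]
  have he2 : e (2 * Real.pi) = e 0 := by
    simp [he, Complex.exp_two_pi_mul_I]
  have hs2 : s (2 * Real.pi) = -s 0 := by
    have hq2 : q (2 * Real.pi) = q 0 := by simp only [hq, he2]
    have hpi : ((2 * Real.pi : ℝ) : ℂ) / 2 * Complex.I = Real.pi * Complex.I := by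
      push_cast
      ring
    simp only [hs, hq2, hpi, Complex.exp_pi_mul_I]
    simp
  have hcase := isPreconnected_univ.eq_or_eq_neg_of_sq_eq (f := fun θ => h (e θ)) (g := s)
    (hc.comp hec).continuousOn hsc.continuousOn (fun θ _ => hsq θ) (fun {θ} _ => hs0 θ)
  have hcontra : s 0 = -s 0 := by
    rcases hcase with hcase | hcase
    · have h1 := hcase (Set.mem_univ 0)
      have h2 := hcase (Set.mem_univ (2 * Real.pi))
      simp only [he2, hs2] at h1 h2
      rw [← h2, ← h1]
    · have h1 := hcase (Set.mem_univ 0)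
      have h2 := hcase (Set.mem_univ (2 * Real.pi))
      simp only [he2, Pi.neg_apply, hs2, neg_neg] at h1 h2
      rw [← h1, h2]
  exact hs0 0 (self_eq_neg.1 hcontra)

theorem HasGeometricDerivBound.not_hasHypercyclicAlgebra_exp {Φ : ℂ → ℂ} {C τ : ℝ} {a : ℂ}
    (h : HasGeometricDerivBound Φ C τ) (ha : ∀ z, Φ z = Complex.exp (a * z)) :
    ¬ HasHypercyclicAlgebra (convolutionOp Φ) := by
  rintro ⟨A, hA, hhyp⟩
  obtain ⟨f, hfA, hf0⟩ : ∃ f ∈ A, f ≠ 0 := by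
    by_contra! hcon
    exact hA (le_bot_iff.1 fun f hf => NonUnitalAlgebra.mem_bot.2 (hcon f hf))
  -- The square stays in the algebra, so it would have to be hypercyclic too.
  have hff : f * f ≠ 0 := by
    intro hzero
    refine hf0 (Subtype.ext (ContinuousMap.ext fun z => ?_))
    have : (f * f).1 z = (0 : entireFunctions).1 z := by rw [hzero]
    exact mul_self_eq_zero.1 this
  have hd := hhyp (f * f) (A.mul_mem hfA hfA) hff
  have hiter : ∀ (N : ℕ) (g : entireFunctions) (z : ℂ),
      ((convolutionOp Φ)^[N] g).1 z = g.1 (z + N * a) := by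
    intro N
    induction N with
    | zero => simp
    | succ N ih =>
      intro g z
      rw [Function.iterate_succ_apply', h.convolutionOp_exp_apply ha, ih]
      congr 1
      push_cast
      ring
  have hnhds : ∀ᶠ g in 𝓝 (monomialFun 1), ∀ z : ℂ, ‖z‖ ≤ 1 →
      ‖g.1 z - (monomialFun 1).1 z‖ < 1 :=
    tendsto_iff.1 tendsto_id 1 one_pos 1 one_pos
  obtain ⟨_, hg, N, rfl⟩ := mem_closure_iff_nhds.1 (hd (monomialFun 1)) _ hnhds
  refine not_forall_norm_sq_sub_lt_one (h := fun z => f.1 (z + N * a)) (by fun_prop) fun z hz => ?_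
  have h1 := hg z hz
  change ‖((convolutionOp Φ)^[N] (f * f)).1 z - z ^ 1‖ < 1 at h1
  rw [hiter, pow_one] at h1
  rw [sq]
  exact h1

end HypercyclicAlgebra

end

theorem theorem1p2 (Φ : ℂ → ℂ) (hΦ : Differentiable ℂ Φ) (hconst : ¬ ∃ c, ∀ z, Φ z = c)
    (hexp : HypercyclicAlgebra.IsExponentialType Φ) (h0 : Φ 0 = 1) :
    (HypercyclicAlgebra.IsSubexponential Φ →
      HypercyclicAlgebra.HasHypercyclicAlgebra (HypercyclicAlgebra.convolutionOp Φ)) ∧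
    (¬ HypercyclicAlgebra.IsSubexponential Φ →
      ((∀ z, Φ z ≠ 0) →
        ¬ HypercyclicAlgebra.HasHypercyclicAlgebra (HypercyclicAlgebra.convolutionOp Φ)) ∧
      (∀ (a : ℂ) (p : Polynomial ℂ), a ≠ 0 → p.coeff 0 = 1 → 0 < p.natDegree →
        (∀ z, Φ z = Complex.exp (a * z) * p.eval z) →
        (p.coeff 1 * a⁻¹ ∉ Set.range (fun x : ℝ => (x : ℂ)) ∨
          2 * p.coeff 2 ≠ p.coeff 1 ^ 2) →
        HypercyclicAlgebra.HasHypercyclicAlgebra (HypercyclicAlgebra.convolutionOp Φ)) ∧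
      ({w | Φ w = 0}.Infinite →
        ∀ (a : ℂ) (p : ℕ) (z : ℕ → ℂ),
          HypercyclicAlgebra.IsHadamardFactorization Φ a p z →
          (∑' n, (z n ^ 2)⁻¹) ≠ 0 →
          (Summable (fun n => ‖z n‖⁻¹) →
            HypercyclicAlgebra.HasHypercyclicAlgebra (HypercyclicAlgebra.convolutionOp Φ)) ∧
          (¬ Summable (fun n => ‖z n‖⁻¹) → a ≠ 0 →
            HypercyclicAlgebra.HasHypercyclicAlgebra (HypercyclicAlgebra.convolutionOp Φ)))) := by
  obtain ⟨C, σ, hC, hσ, hle⟩ := hexp.exists_norm_le hΦ.continuous hconst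
  have hbound := HypercyclicAlgebra.hasGeometricDerivBound_of_norm_le hΦ (by linarith) hσ hle
  -- A zero excludes the exponential form; the factorizations below serve only to produce one.
  have hzero : (∃ w, Φ w = 0) →
      HypercyclicAlgebra.HasHypercyclicAlgebra (HypercyclicAlgebra.convolutionOp Φ) := by
    rintro ⟨w, hw⟩
    refine hbound.hasHypercyclicAlgebra hΦ h0 ?_
    rintro ⟨a, ha⟩
    exact Complex.exp_ne_zero (a * w) (by rw [← ha, hw])
  refine ⟨fun hsub => hbound.hasHypercyclicAlgebra hΦ h0 (hsub.not_exp hconst),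
    fun _ => ⟨?_, ?_, ?_⟩⟩
  · intro hne
    obtain ⟨a, ha⟩ := HypercyclicAlgebra.eq_exp_of_forall_ne_zero hΦ h0 hC hσ hle hne
    exact hbound.not_hasHypercyclicAlgebra_exp ha
  · intro a p _ _ hdeg hfac _
    obtain ⟨w, hw⟩ := IsAlgClosed.exists_root p (Polynomial.natDegree_pos_iff_degree_pos.1 hdeg).ne'
    exact hzero ⟨w, by rw [hfac, hw.eq_zero, mul_zero]⟩
  · intro hinf a p z _ _
    obtain ⟨w, hw⟩ := hinf.nonempty
    exact ⟨fun _ => hzero ⟨w, hw⟩, fun _ _ => hzero ⟨w, hw⟩⟩
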